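/- Let $d\ge 1$ be an integer and let $a,b,c\in\mathbb{R}$ satisfy $a<d/2-1$ and $b>-1$. Let $X\sim N_d(\mu,I)$, with density $\phi(x-\mu)=(2\pi)^{-d/2}\exp(-\|x-\mu\|^2/2)$, and consider the estimation of $\mu\in\mathbb{R}^d$ under the loss $\|\delta-\mu\|^2$. An estimator $\delta$ is inadmissible if some measurable estimator $\delta'$ satisfies $E_\mu\|\delta'(X)-\mu\|^2\le E_\mu\|\delta(X)-\mu\|^2$ for all $\mu$, with strict inequality for some $\mu$. For $g>0$ put $$\pi(g;a,b,c)=(g+1)^a\Big(\frac{g}{g+1}\Big)^b\{\log(g+1)+1\}^c ,$$ and let $\mu$ have the (possibly improper) prior density $$\pi(\mu)=\int_0^\infty g^{-d/2}\exp\Big(-\frac{\|\mu\|^2}{2g}\Big)\,\pi(g;a,b,c)\,dg .$$ Suppose that either $a>0$, or $a=0$ and $c>1$. Then the following hold. (i) For every $x\in\mathbb{R}^d$ the marginal density $m_\pi(x)=\int_{\mathbb{R}^d}\phi(x-\mu)\pi(\mu)\,d\mu$ is positive and finite, and the integral $\int_{\mathbb{R}^d}\mu\,\phi(x-\mu)\pi(\mu)\,d\mu$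 converges absolutely, so the generalized Bayes estimator $$\delta_\pi(x)=\frac{\int_{\mathbb{R}^d}\mu\,\phi(x-\mu)\pi(\mu)\,d\mu}{\int_{\mathbb{R}^d}\phi(x-\mu)\pi(\mu)\,d\mu}$$ is well defined. (ii) $\delta_\pi$ is inadmissible. (iii) $m_\pi(x)$ depends on $x$ only through $\|x\|^2$ and, writing $m_\pi(x)=m_\pi(\|x\|^2)$, both integrals $$\int_1^\infty\frac{dt}{t^{d/2}m_\pi(t)}\qquad\text{and}\qquad\int_1^\infty\frac{dg}{g\,\pi(g;a,b,c)}$$ converge. -/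

import Mathlib

open MeasureTheory Set
open scoped ENNReal

noncomputable section

namespace ScaleMixture

/-- The density `φ` of the standard normal distribution `N_d(0, I)` on `ℝ^d`. -/
def gaussDensity {d : ℕ} (z : EuclideanSpace ℝ (Fin d)) : ℝ :=
  1 / (2 * Real.pi) ^ ((d : ℝ) / 2) * Real.exp (-(‖z‖ ^ 2 / 2))

/-- The sampling distribution `N_d(θ, I)`, which has the density `x ↦ φ (x - θ)`. -/
def sampling {d : ℕ} (θ : EuclideanSpace ℝ (Fin d)) : Measure (EuclideanSpace ℝ (Fin d)) :=
  volume.withDensity fun x => ENNReal.ofReal (gaussDensity (x - θ))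

/-- The risk `R(θ, δ) = E_θ ‖δ(X) - θ‖²` (possibly infinite) of the estimator `δ` of the mean `θ`,
where `X` has the law `N_d(θ, I)`. -/
def risk {d : ℕ} (δ : EuclideanSpace ℝ (Fin d) → EuclideanSpace ℝ (Fin d))
    (θ : EuclideanSpace ℝ (Fin d)) : ℝ≥0∞ :=
  ∫⁻ x, ENNReal.ofReal (‖δ x - θ‖ ^ 2) ∂(sampling θ)

/-- `δ'` dominates `δ`: its risk is nowhere larger and somewhere strictly smaller. -/
def Dominates {d : ℕ} (δ' δ : EuclideanSpace ℝ (Fin d) → EuclideanSpace ℝ (Fin d)) : Prop :=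
  (∀ θ, risk δ' θ ≤ risk δ θ) ∧ ∃ θ, risk δ' θ < risk δ θ

/-- `δ` is inadmissible: some (measurable) estimator dominates it. -/
def IsInadmissible {d : ℕ} (δ : EuclideanSpace ℝ (Fin d) → EuclideanSpace ℝ (Fin d)) : Prop :=
  ∃ δ' : EuclideanSpace ℝ (Fin d) → EuclideanSpace ℝ (Fin d), Measurable δ' ∧ Dominates δ' δ

/-- The marginal density `m_P(x) = ∫ φ(x - θ) P(dθ)` under the prior measure `P`. -/
def marginal {d : ℕ} (P : Measure (EuclideanSpace ℝ (Fin d)))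
    (x : EuclideanSpace ℝ (Fin d)) : ℝ :=
  ∫ θ, gaussDensity (x - θ) ∂P

/-- The generalized Bayes estimator
`δ_P(x) = (∫ θ φ(x - θ) P(dθ)) / (∫ φ(x - θ) P(dθ))` under the prior measure `P`. -/
def genBayes {d : ℕ} (P : Measure (EuclideanSpace ℝ (Fin d)))
    (x : EuclideanSpace ℝ (Fin d)) : EuclideanSpace ℝ (Fin d) :=
  (marginal P x)⁻¹ • ∫ θ, gaussDensity (x - θ) • θ ∂P

/-- The mixing density `π(g; a, b, c)`, for `g > 0`. -/
def mixDensity (a b c g : ℝ) : ℝ :=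
  (g + 1) ^ a * (g / (g + 1)) ^ b * (Real.log (g + 1) + 1) ^ c

/-- The measure `π(g; a, b, c) dg` on `(0, ∞)`. -/
def mixMeasure (a b c : ℝ) : Measure ℝ :=
  (volume.restrict (Ioi 0)).withDensity fun g => ENNReal.ofReal (mixDensity a b c g)

/-- The prior on `ℝ^d` with Lebesgue density
`θ ↦ ∫ g^(-d/2) exp (-‖θ‖² / (2 g)) Q(dg)`, where `Q` is a mixing measure on `(0, ∞)`.
The density may be infinite at `θ = 0`, so it is taken with values in `[0, ∞]`. -/
def mixPrior (d : ℕ) (Q : Measure ℝ) : Measure (EuclideanSpace ℝ (Fin d)) :=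
  volume.withDensity fun θ =>
    ∫⁻ g, ENNReal.ofReal (g ^ (-((d : ℝ) / 2)) * Real.exp (-(‖θ‖ ^ 2 / (2 * g)))) ∂Q

end ScaleMixture

end

namespace ScaleMixture

/-! Write `t = ‖x‖²`. Integrating `θ` out of the Gaussian scale mixture gives `m(t) = ∫
exp(-t/(2(1+g))) w(g) dg` with `w(g) = (g+1)^(-d/2) π(g)`, and `δ_π(x) = (1 - r(t)) x` with `0 ≤ r ≤
1` and `m' = -m r / 2`.

Restricting this integral to `[t, 2t]` gives `m(t) ≥ κ t w(t)`. Hence `1/(t^(d/2) m(t))` is at most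
a constant times `1/(t π(t))`, which is integrable at infinity when `a > 0`, or `a = 0` and `c > 1`.
So Brown's integral converges (`integrableOn_inv_expTransform`).

For `δ_π(x) - h(t) x`, Stein's identity (`integral_stein_radial`) turns the change in risk into the
expectation of `t h² + 2 t h r - 2 (d h + 2 t h')`. Take `h = 1/P` with `P = (1+t)^(d/2) G m`. The
factor `m` cancels the term in `r`, the tail integral `G`, finite by Brown's condition, cancels the
term in `h²`, and `(1+t)^(d/2)` leaves exactly `-2d/(P (1+t)) < 0`. The risk therefore drops
strictly at every `θ` (`risk_lt_of_radial`, `exists_dominating_radial`). -/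

/-! ### The mixing density: algebra and integrability. -/

theorem measurable_mixDensity (a b c : ℝ) : Measurable (mixDensity a b c) := by
  unfold mixDensity
  fun_prop

theorem one_le_log_add_one {g : ℝ} (hg : 0 ≤ g) : 1 ≤ Real.log (g + 1) + 1 := by
  linarith [Real.log_nonneg (by linarith : (1 : ℝ) ≤ g + 1)]

theorem mixDensity_pos (a b c : ℝ) {g : ℝ} (hg : 0 < g) : 0 < mixDensity a b c g := by
  have := one_le_log_add_one hg.le
  unfold mixDensity
  positivity

/-- With `p = -d/2`, this absorbs the Gaussian factor `(g+1)^(-d/2)` into a shift of `a`. -/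
theorem rpow_mul_mixDensity (p a b c : ℝ) {g : ℝ} (hg : 0 < g) :
    (g + 1) ^ p * mixDensity a b c g = mixDensity (p + a) b c g := by
  unfold mixDensity
  rw [Real.rpow_add (by linarith)]
  ring

/-- The family is closed under `π ↦ 1/(g π)`, so one integrability criterion also serves the
reciprocal integral. -/
theorem inv_mul_mixDensity (a b c : ℝ) {g : ℝ} (hg : 0 < g) :
    1 / (g * mixDensity a b c g) = mixDensity (-a - 1) (-b - 1) (-c) g := by
  have hL := one_le_log_add_one hg.le
  have h1 : 0 < g + 1 := by linarith
  unfold mixDensity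
  rw [Real.rpow_sub h1, Real.rpow_sub (by positivity), Real.rpow_neg h1.le,
    Real.rpow_neg (by positivity), Real.rpow_neg (by linarith), Real.rpow_one, Real.rpow_one]
  have := Real.rpow_pos_of_pos h1 a
  have := Real.rpow_pos_of_pos (div_pos hg h1) b
  have := Real.rpow_pos_of_pos (by linarith : 0 < Real.log (g + 1) + 1) c
  field_simp

theorem exists_log_rpow_le (c : ℝ) {η : ℝ} (hη : 0 < η) :
    ∃ C, 0 < C ∧ ∀ g : ℝ, 0 ≤ g → (Real.log (g + 1) + 1) ^ c ≤ C * (g + 1) ^ η := by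
  -- The maximum keeps the exponent positive, so that `log y ≤ y^ε / ε` with `ε = η/k` can be raised
  -- to the power `k`.
  set k := max c 1
  have hk : 0 < k := lt_max_of_lt_right one_pos
  have hε : 0 < η / k := div_pos hη hk
  refine ⟨(1 + 1 / (η / k)) ^ k, by positivity, fun g hg => ?_⟩
  have hL := one_le_log_add_one hg
  have h1 : (1 : ℝ) ≤ (g + 1) ^ (η / k) := Real.one_le_rpow (by linarith) hε.le
  calc (Real.log (g + 1) + 1) ^ c ≤ (Real.log (g + 1) + 1) ^ k :=
        Real.rpow_le_rpow_of_exponent_le hL (le_max_left _ _)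
    _ ≤ ((1 + 1 / (η / k)) * (g + 1) ^ (η / k)) ^ k := by
        refine Real.rpow_le_rpow (by linarith) ?_ hk.le
        have := Real.log_le_rpow_div (by linarith : 0 ≤ g + 1) hε
        rw [add_mul, one_mul, one_div_mul_eq_div]
        linarith
    _ = (1 + 1 / (η / k)) ^ k * (g + 1) ^ η := by
        rw [Real.mul_rpow (by positivity) (by positivity), ← Real.rpow_mul (by linarith),
          div_mul_cancel₀ _ hk.ne']

theorem div_add_one_rpow_le (b : ℝ) {g : ℝ} (hg : 1 < g) :
    (g / (g + 1)) ^ b ≤ (1 / 2) ^ (-|b|) := by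
  have h1 : g / (g + 1) ≤ 1 := (div_le_one (by linarith)).2 (by linarith)
  have h2 : 1 / 2 ≤ g / (g + 1) := by rw [div_le_div_iff₀ (by norm_num) (by linarith)]; linarith
  calc (g / (g + 1)) ^ b ≤ (g / (g + 1)) ^ (-|b|) :=
        Real.rpow_le_rpow_of_exponent_ge (by linarith) h1 (neg_abs_le b)
    _ ≤ _ := Real.rpow_le_rpow_of_nonpos (by norm_num) h2 (by simp)

/-- On `g > 1` the factor with exponent `b` is bounded, so only the power and the logarithm matter.
-/
theorem integrableOn_mixDensity_Ioi_one {a b c : ℝ} (h : a < -1 ∨ a = -1 ∧ c < -1) :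
    IntegrableOn (mixDensity a b c) (Ioi 1) := by
  suffices H : IntegrableOn (fun g : ℝ => (g + 1) ^ a * (Real.log (g + 1) + 1) ^ c) (Ioi 1) by
    refine (H.const_mul ((1 / 2) ^ (-|b|))).mono' (measurable_mixDensity a b c).aestronglyMeasurable
      ((ae_restrict_mem measurableSet_Ioi).mono fun g hg => ?_)
    have hg0 : (0 : ℝ) < g := one_pos.trans hg
    rw [Real.norm_of_nonneg (mixDensity_pos a b c hg0).le, mixDensity]
    have := mul_le_mul_of_nonneg_right (div_add_one_rpow_le b hg)
      (mul_nonneg (Real.rpow_nonneg (by linarith : 0 ≤ g + 1) a)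
        (Real.rpow_nonneg (by linarith [one_le_log_add_one hg0.le] :
          0 ≤ Real.log (g + 1) + 1) c))
    linarith
  rcases h with h | ⟨rfl, h⟩
  -- The logarithm is given half of the gap `-1 - a`; the remaining exponent `(a-1)/2` is still
  -- below `-1`.
  · obtain ⟨C, hC, hCle⟩ := exists_log_rpow_le c (by linarith : 0 < (-1 - a) / 2)
    refine ((integrableOn_Ioi_rpow_of_lt (by linarith : (a - 1) / 2 < -1) one_pos).const_mul C).mono'
      (by fun_prop) ((ae_restrict_mem measurableSet_Ioi).mono fun g hg => ?_)
    have hg : (1 : ℝ) < g := hg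
    have hL := one_le_log_add_one (by linarith : 0 ≤ g)
    rw [Real.norm_of_nonneg (by positivity)]
    calc (g + 1) ^ a * (Real.log (g + 1) + 1) ^ c
        ≤ (g + 1) ^ a * (C * (g + 1) ^ ((-1 - a) / 2)) := by
          have := hCle g (by linarith)
          gcongr
      _ = C * (g + 1) ^ ((a - 1) / 2) := by
          rw [mul_left_comm, ← Real.rpow_add (by linarith)]
          congr 2
          ring
      _ ≤ C * g ^ ((a - 1) / 2) := by
          have := Real.rpow_le_rpow_of_nonpos (by linarith : 0 < g) (by linarith : g ≤ g + 1)
            (by linarith : (a - 1) / 2 ≤ 0)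
          gcongr
  -- In the boundary case the integrand has the explicit antiderivative `(log(g+1)+1)^(c+1)/(c+1)`,
  -- which vanishes at infinity because `c < -1`.
  · refine integrableOn_Ioi_deriv_of_nonneg'
      (g := fun g => (Real.log (g + 1) + 1) ^ (c + 1) / (c + 1)) (l := 0) ?_ ?_ ?_
    · intro g hg
      have hg : (1 : ℝ) ≤ g := hg
      have hL := one_le_log_add_one (by linarith : 0 ≤ g)
      have h1 : HasDerivAt (fun g : ℝ => Real.log (g + 1) + 1) ((g + 1)⁻¹) g := by
        simpa using (((hasDerivAt_id g).add_const 1).log (by simp; linarith)).add_const 1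
      refine ((h1.rpow_const (p := c + 1) (Or.inl (by linarith))).div_const (c + 1)).congr_deriv ?_
      rw [Real.rpow_neg_one, add_sub_cancel_right]
      field_simp [(by linarith : c + 1 ≠ 0)]
    · intro g hg
      have hg : (1 : ℝ) < g := hg
      have hL := one_le_log_add_one (by linarith : 0 ≤ g)
      positivity
    · have ht : Filter.Tendsto (fun g : ℝ => Real.log (g + 1) + 1) Filter.atTop Filter.atTop :=
        Filter.tendsto_atTop_add_const_right _ _
          (Real.tendsto_log_atTop.comp (Filter.tendsto_atTop_add_const_right _ _ Filter.tendsto_id))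
      have := ((tendsto_rpow_neg_atTop (by linarith : 0 < -(c + 1))).comp ht).div_const (c + 1)
      simpa [Function.comp_def] using this

theorem integrableOn_mixDensity_Ioi_zero {a b c : ℝ} (ha : a < -1) (hb : -1 < b) :
    IntegrableOn (mixDensity a b c) (Ioi 0) := by
  rw [← Ioc_union_Ioi_eq_Ioi (zero_le_one' ℝ)]
  refine IntegrableOn.union ?_ (integrableOn_mixDensity_Ioi_one (Or.inl ha))
  have h1 : IntegrableOn (fun g : ℝ => g ^ b) (Icc 0 1) := by
    rw [integrableOn_Icc_iff_integrableOn_Ioc,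
      ← intervalIntegrable_iff_integrableOn_Ioc_of_le zero_le_one]
    exact intervalIntegral.intervalIntegrable_rpow' hb
  have h2 : ContinuousOn (fun g : ℝ => (g + 1) ^ (a - b) * (Real.log (g + 1) + 1) ^ c)
      (Icc 0 1) := by
    refine ContinuousOn.mul (ContinuousOn.rpow_const (by fun_prop) fun g hg => Or.inl ?_)
      (ContinuousOn.rpow_const (ContinuousOn.add (ContinuousOn.log (by fun_prop)
        fun g hg => ?_) continuousOn_const) fun g hg => Or.inl ?_)
    · linarith [hg.1]
    · linarith [hg.1]
    · linarith [one_le_log_add_one hg.1]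
  refine ((h1.mul_continuousOn h2 isCompact_Icc).mono_set Ioc_subset_Icc_self).congr_fun
    (fun g hg => ?_) measurableSet_Ioc
  have h3 : 0 < g + 1 := by linarith [hg.1]
  simp only [mixDensity]
  rw [Real.rpow_sub h3, Real.div_rpow hg.1.le h3.le]
  field_simp

theorem integrableOn_inv_mul_mixDensity {a b c : ℝ} (h : 0 < a ∨ (a = 0 ∧ 1 < c)) :
    IntegrableOn (fun g : ℝ => 1 / (g * mixDensity a b c g)) (Ioi 1) := by
  refine (integrableOn_mixDensity_Ioi_one (a := -a - 1) (b := -b - 1) (c := -c) ?_).congr_fun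
    (fun g hg => (inv_mul_mixDensity a b c (one_pos.trans hg)).symm) measurableSet_Ioi
  rcases h with h | ⟨rfl, h⟩
  · exact Or.inl (by linarith)
  · exact Or.inr ⟨by norm_num, by linarith⟩

/-! ### The transform giving the marginal density: derivative, positivity, growth. -/

/-- The transform `t ↦ ∫₀^∞ exp (-t / (2 (1 + g))) w(g) dg` of a weight `w` on `(0, ∞)`. -/
noncomputable def expTransform (w : ℝ → ℝ) (t : ℝ) : ℝ :=
  ∫ g in Ioi (0 : ℝ), Real.exp (-(t / (2 * (1 + g)))) * w g

/-- Negative `t` are covered because the transform is later differentiated two-sidedly at `t = 0`.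
-/
theorem exp_neg_div_le {t s g : ℝ} (hg : 0 < g) (hts : |t| ≤ s) :
    Real.exp (-(t / (2 * (1 + g)))) ≤ Real.exp (s / 2) := by
  refine Real.exp_le_exp.2 ?_
  rw [← neg_div, div_le_div_iff₀ (by linarith) (by norm_num)]
  nlinarith [neg_le_abs t, abs_nonneg t]

theorem integrableOn_expTransform {w : ℝ → ℝ} (hw : IntegrableOn w (Ioi 0)) (t : ℝ) :
    IntegrableOn (fun g => Real.exp (-(t / (2 * (1 + g)))) * w g) (Ioi 0) := by
  refine Integrable.bdd_mul (c := Real.exp (|t| / 2)) hw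
    (Measurable.aestronglyMeasurable (by fun_prop))
    ((ae_restrict_mem measurableSet_Ioi).mono fun g hg => ?_)
  rw [Real.norm_of_nonneg (Real.exp_nonneg _)]
  exact exp_neg_div_le hg le_rfl

theorem integrableOn_div_one_add {w : ℝ → ℝ} (hw : IntegrableOn w (Ioi 0)) :
    IntegrableOn (fun g => w g / (1 + g)) (Ioi 0) := by
  have : IntegrableOn (fun g => (1 + g)⁻¹ * w g) (Ioi 0) := by
    refine Integrable.bdd_mul (c := 1) hw
      (Measurable.aestronglyMeasurable (by fun_prop))
      ((ae_restrict_mem measurableSet_Ioi).mono fun g hg => ?_)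
    have hg : (0 : ℝ) < g := hg
    rw [Real.norm_of_nonneg (by positivity)]
    exact inv_le_one_of_one_le₀ (by linarith)
  exact this.congr_fun (fun g _ => inv_mul_eq_div _ _) measurableSet_Ioi

theorem hasDerivAt_expTransform {w : ℝ → ℝ} (hw : IntegrableOn w (Ioi 0)) (t : ℝ) :
    HasDerivAt (expTransform w) (-(expTransform (fun g => w g / (1 + g)) t / 2)) t := by
  have hb := (integrableOn_div_one_add hw).norm.const_mul (Real.exp ((|t| + 1) / 2) / 2)
  have key := hasDerivAt_integral_of_dominated_loc_of_deriv_le (Metric.ball_mem_nhds t one_pos)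
    (μ := volume.restrict (Ioi (0 : ℝ)))
    (F := fun t g => Real.exp (-(t / (2 * (1 + g)))) * w g)
    (F' := fun t g => Real.exp (-(t / (2 * (1 + g)))) * (w g / (1 + g)) * (-1 / 2))
    (Filter.Eventually.of_forall fun s => (integrableOn_expTransform hw s).aestronglyMeasurable)
    (integrableOn_expTransform hw t)
    ((integrableOn_expTransform (integrableOn_div_one_add hw) t).mul_const _).aestronglyMeasurable
    ((ae_restrict_mem measurableSet_Ioi).mono fun g hg s hs => ?_) hb
    ((ae_restrict_mem measurableSet_Ioi).mono fun g hg s hs => ?_)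
  · refine key.2.congr_deriv ?_
    rw [integral_mul_const, expTransform]
    ring
  · have hs' : |s| ≤ |t| + 1 := by
      rw [Metric.mem_ball, Real.dist_eq] at hs
      linarith [abs_sub_abs_le_abs_sub s t]
    rw [norm_mul, norm_mul, Real.norm_of_nonneg (Real.exp_nonneg _)]
    have := mul_le_mul_of_nonneg_right (exp_neg_div_le hg hs') (norm_nonneg (w g / (1 + g)))
    norm_num at this ⊢
    linarith
  · have hg : (0 : ℝ) < g := hg
    refine ((((hasDerivAt_id s).div_const (2 * (1 + g))).neg.exp).mul_const (w g)).congr_deriv ?_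
    simp only [id, Pi.neg_apply]
    field_simp

theorem continuous_expTransform {w : ℝ → ℝ} (hw : IntegrableOn w (Ioi 0)) :
    Continuous (expTransform w) :=
  continuous_iff_continuousAt.2 fun t => (hasDerivAt_expTransform hw t).continuousAt

theorem expTransform_pos {w : ℝ → ℝ} (hw : IntegrableOn w (Ioi 0)) (h0 : ∀ g, 0 < g → 0 < w g)
    (t : ℝ) : 0 < expTransform w t := by
  rw [expTransform, setIntegral_pos_iff_support_of_nonneg_ae
    ((ae_restrict_mem measurableSet_Ioi).mono fun g hg =>
      mul_nonneg (Real.exp_nonneg _) (h0 g hg).le) (integrableOn_expTransform hw t)]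
  have : Function.support (fun g => Real.exp (-(t / (2 * (1 + g)))) * w g) ∩ Ioi 0 = Ioi 0 :=
    inter_eq_right.2 fun g hg => (mul_pos (Real.exp_pos _) (h0 g hg)).ne'
  rw [this]
  simp

theorem expTransform_div_one_add_le {w : ℝ → ℝ} (hw : IntegrableOn w (Ioi 0))
    (h0 : ∀ g, 0 < g → 0 < w g) (t : ℝ) :
    expTransform (fun g => w g / (1 + g)) t ≤ expTransform w t := by
  refine setIntegral_mono_on (integrableOn_expTransform (integrableOn_div_one_add hw) t)
    (integrableOn_expTransform hw t) measurableSet_Ioi fun g hg => ?_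
  have hg' : (0 : ℝ) < g := hg
  have := div_le_self (h0 g hg).le (by linarith : 1 ≤ 1 + g)
  gcongr

/-- For `g > 1/ε` the exponent `t/(2(1+g))` is below `ε t`, so this part of the integral decays no
faster than `exp(-ε t)`. This makes `1/m` harmless under a Gaussian weight. -/
theorem exists_inv_expTransform_le {w : ℝ → ℝ} (hw : IntegrableOn w (Ioi 0))
    (h0 : ∀ g, 0 < g → 0 < w g) {ε : ℝ} (hε : 0 < ε) :
    ∃ C, 0 < C ∧ ∀ t, 0 ≤ t → (expTransform w t)⁻¹ ≤ C * Real.exp (ε * t) := by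
  set M := 1 / ε
  have hM : 0 < M := by positivity
  have hsub : Ioi M ⊆ Ioi 0 := Ioi_subset_Ioi hM.le
  have hpos : 0 < ∫ g in Ioi M, w g := by
    rw [setIntegral_pos_iff_support_of_nonneg_ae ((ae_restrict_mem measurableSet_Ioi).mono
      fun g hg => (h0 g (hsub hg)).le) (hw.mono_set hsub)]
    have : Function.support w ∩ Ioi M = Ioi M :=
      inter_eq_right.2 fun g hg => (h0 g (hsub hg)).ne'
    rw [this]
    simp
  refine ⟨(∫ g in Ioi M, w g)⁻¹, by positivity, fun t ht => ?_⟩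
  rw [← neg_neg (ε * t), Real.exp_neg, ← mul_inv]
  refine inv_anti₀ (by positivity) ?_
  rw [← integral_mul_const, expTransform]
  refine le_trans ?_ (setIntegral_mono_set (integrableOn_expTransform hw t)
    ((ae_restrict_mem measurableSet_Ioi).mono fun g hg =>
      mul_nonneg (Real.exp_nonneg _) (h0 g hg).le) hsub.eventuallyLE)
  refine setIntegral_mono_on ((hw.mono_set hsub).mul_const _)
    ((integrableOn_expTransform hw t).mono_set hsub) measurableSet_Ioi fun g hg => ?_
  rw [mul_comm]
  refine mul_le_mul_of_nonneg_right (Real.exp_le_exp.2 (neg_le_neg ?_)) (h0 g (hsub hg)).le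
  have hg : 1 / ε < g := hg
  have hg0 : 0 < g := hM.trans hg
  rw [div_lt_iff₀ hε] at hg
  rw [div_le_iff₀ (by positivity)]
  nlinarith [mul_nonneg hε.le ht]

/-! ### Lower bound for the marginal and Brown's integral. -/

theorem two_rpow_mul_rpow_le {x y : ℝ} (hx : 0 < x) (h1 : x / 2 ≤ y) (h2 : y ≤ 2 * x) (p : ℝ) :
    2 ^ (-|p|) * x ^ p ≤ y ^ p := by
  rcases le_total 0 p with hp | hp
  · rw [abs_of_nonneg hp]
    refine le_trans (le_of_eq ?_) (Real.rpow_le_rpow (by positivity) h1 hp)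
    rw [Real.div_rpow hx.le zero_le_two, Real.rpow_neg zero_le_two]
    ring
  · rw [abs_of_nonpos hp, neg_neg, ← Real.mul_rpow zero_le_two hx.le]
    exact Real.rpow_le_rpow_of_nonpos (by linarith) h2 hp

/-- On `[t, 2t]` each of the three bases changes by a factor of at most 2; for the logarithm this
uses `log 2 ≤ 1 ≤ log(t+1) + 1`. -/
theorem exists_mul_mixDensity_le (a b c : ℝ) : ∃ κ, 0 < κ ∧ ∀ t g : ℝ, 1 ≤ t → t ≤ g → g ≤ 2 * t →
    κ * mixDensity a b c t ≤ mixDensity a b c g := by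
  refine ⟨2 ^ (-|a|) * 2 ^ (-|b|) * 2 ^ (-|c|), by positivity, fun t g ht h1 h2 => ?_⟩
  have hLt := one_le_log_add_one (by linarith : 0 ≤ t)
  have hLg := one_le_log_add_one (by linarith : 0 ≤ g)
  have e1 := two_rpow_mul_rpow_le (x := t + 1) (y := g + 1) (by linarith) (by linarith)
    (by linarith) a
  have e2 := two_rpow_mul_rpow_le (x := t / (t + 1)) (y := g / (g + 1)) (by positivity)
    (by rw [div_div, div_le_div_iff₀ (by linarith) (by linarith)]; nlinarith)
    (by rw [← mul_div_assoc, div_le_div_iff₀ (by linarith) (by linarith)]; nlinarith) b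
  have hlog1 : Real.log (t + 1) ≤ Real.log (g + 1) := Real.log_le_log (by linarith) (by linarith)
  have hlog2 : Real.log (g + 1) ≤ Real.log 2 + Real.log (t + 1) := by
    rw [← Real.log_mul (by norm_num) (by linarith)]
    exact Real.log_le_log (by linarith) (by linarith)
  have hlog3 : Real.log 2 ≤ 1 := by linarith [Real.log_two_lt_d9]
  have e3 := two_rpow_mul_rpow_le (x := Real.log (t + 1) + 1) (y := Real.log (g + 1) + 1)
    (by linarith) (by linarith) (by linarith) c
  have ht0 : 0 < t := by linarith
  have hg0 : 0 < g := by linarith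
  unfold mixDensity
  calc _ = (2 ^ (-|a|) * (t + 1) ^ a) * (2 ^ (-|b|) * (t / (t + 1)) ^ b)
        * (2 ^ (-|c|) * (Real.log (t + 1) + 1) ^ c) := by ring
    _ ≤ _ := by gcongr

/-- Only `[t, 2t]` is kept: its length is `t`, the weight there is comparable to its value at `t`,
and `g ≥ t` makes the exponential at least `exp(-1/2)`. -/
theorem exists_le_expTransform_mixDensity {a b c : ℝ} (ha : a < -1) (hb : -1 < b) :
    ∃ κ, 0 < κ ∧ ∀ t : ℝ, 1 ≤ t → κ * (t * mixDensity a b c t) ≤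
      expTransform (mixDensity a b c) t := by
  obtain ⟨κ, hκ, h⟩ := exists_mul_mixDensity_le a b c
  refine ⟨Real.exp (-(1 / 2)) * κ, by positivity, fun t ht => ?_⟩
  have hw : IntegrableOn (mixDensity a b c) (Ioi 0) := integrableOn_mixDensity_Ioi_zero ha hb
  have hsub : Icc t (2 * t) ⊆ Ioi (0 : ℝ) := fun g hg => show 0 < g by linarith [hg.1]
  refine le_trans ?_ (setIntegral_mono_set (integrableOn_expTransform hw t)
    ((ae_restrict_mem measurableSet_Ioi).mono fun g hg =>
      mul_nonneg (Real.exp_nonneg _) (mixDensity_pos a b c hg).le) hsub.eventuallyLE)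
  have : Real.exp (-(1 / 2)) * κ * (t * mixDensity a b c t) =
      ∫ _ in Icc t (2 * t), Real.exp (-(1 / 2)) * (κ * mixDensity a b c t) := by
    rw [setIntegral_const, measureReal_def, Real.volume_Icc,
      ENNReal.toReal_ofReal (by linarith), smul_eq_mul]
    ring
  rw [this]
  refine setIntegral_mono_on continuousOn_const.integrableOn_Icc ((integrableOn_expTransform hw t).mono_set hsub)
    measurableSet_Icc fun g hg => ?_
  have hp := mixDensity_pos a b c (by linarith : 0 < t)
  refine mul_le_mul (Real.exp_le_exp.2 (neg_le_neg ?_)) (h t g ht hg.1 hg.2) (by positivity)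
    (Real.exp_nonneg _)
  rw [div_le_div_iff₀ (by linarith [hg.1]) (by norm_num)]
  linarith [hg.1]

theorem integrableOn_inv_expTransform {d a b c : ℝ} (hd : 0 ≤ d) (had : a - d / 2 < -1)
    (hb : -1 < b) (h : 0 < a ∨ (a = 0 ∧ 1 < c)) :
    IntegrableOn (fun t : ℝ => 1 / (t ^ (d / 2) * expTransform (mixDensity (a - d / 2) b c) t))
      (Ioi 1) := by
  obtain ⟨κ, hκ, hle⟩ := exists_le_expTransform_mixDensity (c := c) had hb
  have hw : IntegrableOn (mixDensity (a - d / 2) b c) (Ioi 0) :=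
    integrableOn_mixDensity_Ioi_zero had hb
  have hm := (continuous_expTransform hw).measurable
  refine ((integrableOn_inv_mul_mixDensity (b := b) h).const_mul (2 ^ (d / 2) / κ)).mono'
    (Measurable.aestronglyMeasurable (by fun_prop))
    ((ae_restrict_mem measurableSet_Ioi).mono fun t ht => ?_)
  have ht : (1 : ℝ) < t := ht
  have ht0 : (0 : ℝ) < t := by linarith
  have hmt := expTransform_pos hw (fun g hg => mixDensity_pos _ b c hg) t
  have hp := mixDensity_pos a b c ht0
  have hp' := mixDensity_pos (a - d / 2) b c ht0
  rw [Real.norm_of_nonneg (by positivity), div_mul_div_comm, mul_one,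
    div_le_div_iff₀ (by positivity) (by positivity), one_mul]
  have e1 : mixDensity a b c t ≤ 2 ^ (d / 2) * (t ^ (d / 2) * mixDensity (a - d / 2) b c t) := by
    calc mixDensity a b c t = (t + 1) ^ (d / 2) * mixDensity (a - d / 2) b c t := by
          rw [rpow_mul_mixDensity _ _ _ _ ht0]
          congr 1
          ring
      _ ≤ (2 * t) ^ (d / 2) * mixDensity (a - d / 2) b c t := by
          gcongr
          linarith
      _ = _ := by rw [Real.mul_rpow zero_le_two ht0.le]; ring
  calc κ * (t * mixDensity a b c t)
      ≤ κ * (t * (2 ^ (d / 2) * (t ^ (d / 2) * mixDensity (a - d / 2) b c t))) := by gcongr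
    _ = 2 ^ (d / 2) * (t ^ (d / 2) * (κ * (t * mixDensity (a - d / 2) b c t))) := by ring
    _ ≤ _ := by
      gcongr
      exact hle t ht.le

/-! ### Gaussian integrals for a fixed scale `g`. -/

variable {d : ℕ}

/-- The unnormalised `N_d(0, g I)` density `g^(-d/2) exp (-‖θ‖² / (2 g))`. -/
noncomputable def scaleKernel (g : ℝ) (θ : EuclideanSpace ℝ (Fin d)) : ℝ :=
  g ^ (-((d : ℝ) / 2)) * Real.exp (-(‖θ‖ ^ 2 / (2 * g)))

theorem measurable_scaleKernel :
    Measurable fun p : ℝ × EuclideanSpace ℝ (Fin d) => scaleKernel p.1 p.2 := by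
  unfold scaleKernel
  fun_prop

theorem continuous_gaussDensity : Continuous (gaussDensity (d := d)) := by
  unfold gaussDensity
  fun_prop

theorem gaussDensity_pos (z : EuclideanSpace ℝ (Fin d)) : 0 < gaussDensity z := by
  have := Real.pi_pos
  unfold gaussDensity
  positivity

theorem scaleKernel_pos {g : ℝ} (hg : 0 < g) (θ : EuclideanSpace ℝ (Fin d)) :
    0 < scaleKernel g θ := by
  unfold scaleKernel
  positivity

/-- The prior density may be infinite at `0`. As the `θ`-marginal of a joint measure on `(g, θ)`
with a finite kernel, the prior becomes accessible to Fubini. -/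
theorem mixPrior_eq_map (Q : Measure ℝ) [SFinite Q] :
    mixPrior d Q = ((Q.prod volume).withDensity
      fun p => ENNReal.ofReal (scaleKernel p.1 p.2)).map Prod.snd := by
  ext s hs
  have hm : Measurable fun p : ℝ × EuclideanSpace ℝ (Fin d) =>
      ENNReal.ofReal (scaleKernel p.1 p.2) := measurable_scaleKernel.ennreal_ofReal
  rw [Measure.map_apply measurable_snd hs, withDensity_apply _ (measurable_snd hs), mixPrior,
    withDensity_apply _ hs, ← univ_prod, ← Measure.prod_restrict, Measure.restrict_univ,
    lintegral_prod_symm' _ hm]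
  rfl

theorem integrable_exp_neg_mul_sq_norm {β : ℝ} (hβ : 0 < β) :
    Integrable fun u : EuclideanSpace ℝ (Fin d) => Real.exp (-β * ‖u‖ ^ 2) := by
  have := (GaussianFourier.integrable_cexp_neg_mul_sq_norm_add (V := EuclideanSpace ℝ (Fin d))
    (b := (β : ℂ)) (by simpa using hβ) 0 0).norm
  refine this.congr (Filter.Eventually.of_forall fun u => ?_)
  simp only [Complex.norm_exp]
  norm_cast
  simp

theorem integral_exp_neg_mul_sq_norm {β : ℝ} (hβ : 0 < β) :
    ∫ u : EuclideanSpace ℝ (Fin d), Real.exp (-β * ‖u‖ ^ 2) = (Real.pi / β) ^ ((d : ℝ) / 2) := by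
  simpa using GaussianFourier.integral_rexp_neg_mul_sq_norm (V := EuclideanSpace ℝ (Fin d)) hβ

theorem norm_le_exp_sq_div_four {E : Type*} [NormedAddCommGroup E] (u : E) :
    ‖u‖ ≤ Real.exp (‖u‖ ^ 2 / 4) := by
  nlinarith [Real.add_one_le_exp (‖u‖ ^ 2 / 4), sq_nonneg (‖u‖ / 2 - 1)]

theorem norm_mul_exp_le {β : ℝ} (hβ : 1 / 2 ≤ β) (u : EuclideanSpace ℝ (Fin d)) :
    ‖u‖ * Real.exp (-β * ‖u‖ ^ 2) ≤ Real.exp (-(β / 2) * ‖u‖ ^ 2) := by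
  calc _ ≤ Real.exp (‖u‖ ^ 2 / 4) * Real.exp (-β * ‖u‖ ^ 2) := by
        gcongr
        exact norm_le_exp_sq_div_four u
    _ ≤ _ := by
        rw [← Real.exp_add]
        refine Real.exp_le_exp.2 ?_
        nlinarith [sq_nonneg ‖u‖]

/-- Completing the square: given `g`, the posterior of `θ` is normal with mean `g/(1+g) x` and
variance `g/(1+g)`. -/
theorem gaussDensity_mul_scaleKernel {g : ℝ} (hg : 0 < g) (x θ : EuclideanSpace ℝ (Fin d)) :
    gaussDensity (x - θ) * scaleKernel g θ =
      (2 * Real.pi * g) ^ (-((d : ℝ) / 2)) * Real.exp (-(‖x‖ ^ 2 / (2 * (1 + g)))) *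
        Real.exp (-((1 + g) / (2 * g)) * ‖θ - (g / (1 + g)) • x‖ ^ 2) := by
  have h1 : 0 < 1 + g := by linarith
  have hπ := Real.pi_pos
  have e : -(‖x - θ‖ ^ 2 / 2) + -(‖θ‖ ^ 2 / (2 * g)) = -(‖x‖ ^ 2 / (2 * (1 + g))) +
      -((1 + g) / (2 * g)) * ‖θ - (g / (1 + g)) • x‖ ^ 2 := by
    rw [norm_sub_sq_real, norm_sub_sq_real, inner_smul_right, norm_smul, mul_pow, Real.norm_eq_abs,
      sq_abs, real_inner_comm]
    field_simp
    ring
  unfold gaussDensity scaleKernel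
  rw [mul_assoc ((2 * Real.pi * g) ^ (-((d : ℝ) / 2))), ← Real.exp_add, ← e, Real.exp_add,
    Real.mul_rpow (by positivity) hg.le, Real.rpow_neg (by positivity : 0 ≤ 2 * Real.pi), one_div]
  ring

/-- The mean `(1 + g)^(-d/2) exp (-‖x‖² / (2 (1 + g)))` of `φ(x - θ)` under the scale kernel. -/
theorem integral_gaussDensity_mul_scaleKernel {g : ℝ} (hg : 0 < g)
    (x : EuclideanSpace ℝ (Fin d)) :
    ∫ θ, gaussDensity (x - θ) * scaleKernel g θ =
      (g + 1) ^ (-((d : ℝ) / 2)) * Real.exp (-(‖x‖ ^ 2 / (2 * (1 + g)))) := by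
  have h1 : 0 < g + 1 := by linarith
  have hπ := Real.pi_pos
  simp_rw [gaussDensity_mul_scaleKernel hg x]
  rw [integral_const_mul, integral_sub_right_eq_self (μ := volume)
    (fun θ : EuclideanSpace ℝ (Fin d) => Real.exp (-((1 + g) / (2 * g)) * ‖θ‖ ^ 2)),
    integral_exp_neg_mul_sq_norm (by positivity), mul_right_comm]
  congr 1
  have : Real.pi / ((1 + g) / (2 * g)) = 2 * Real.pi * g / (g + 1) := by
    field_simp
    ring
  rw [this, Real.div_rpow (by positivity) h1.le, Real.rpow_neg (by positivity),
    Real.rpow_neg h1.le]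
  have := Real.rpow_pos_of_pos (by positivity : 0 < 2 * Real.pi * g) ((d : ℝ) / 2)
  field_simp

theorem integral_eq_zero_of_neg {E : Type*} [NormedAddCommGroup E] [NormedSpace ℝ E]
    {f : EuclideanSpace ℝ (Fin d) → E} (hf : ∀ u, f (-u) = -f u) : ∫ u, f u = 0 := by
  have h := integral_neg_eq_self f (volume : Measure (EuclideanSpace ℝ (Fin d)))
  simp_rw [hf, integral_neg] at h
  have h2 : (2 : ℝ) • ∫ u, f u = 0 := by
    rw [two_smul]
    nth_rewrite 1 [← h]
    exact neg_add_cancel _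
  exact (smul_eq_zero.1 h2).resolve_left two_ne_zero

theorem integrable_exp_smul_self {β : ℝ} (hβ : 1 / 2 ≤ β) :
    Integrable fun u : EuclideanSpace ℝ (Fin d) => Real.exp (-β * ‖u‖ ^ 2) • u := by
  refine (integrable_exp_neg_mul_sq_norm (by linarith : 0 < β / 2)).mono'
    (Continuous.aestronglyMeasurable (by fun_prop)) (Filter.Eventually.of_forall fun u => ?_)
  rw [norm_smul, Real.norm_of_nonneg (Real.exp_nonneg _), mul_comm]
  exact norm_mul_exp_le hβ u

theorem half_le_one_add_div {g : ℝ} (hg : 0 < g) : 1 / 2 ≤ (1 + g) / (2 * g) := by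
  rw [div_le_div_iff₀ (by norm_num) (by positivity)]
  linarith

theorem integral_gaussDensity_mul_scaleKernel_smul {g : ℝ} (hg : 0 < g)
    (x : EuclideanSpace ℝ (Fin d)) :
    ∫ θ, (gaussDensity (x - θ) * scaleKernel g θ) • θ =
      ((g + 1) ^ (-((d : ℝ) / 2)) * Real.exp (-(‖x‖ ^ 2 / (2 * (1 + g))))) •
        (g / (1 + g)) • x := by
  have hβ := half_le_one_add_div hg
  rw [← integral_gaussDensity_mul_scaleKernel hg x]
  simp_rw [gaussDensity_mul_scaleKernel hg x, mul_smul]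
  rw [integral_smul, integral_smul, integral_const_mul]
  set β := (1 + g) / (2 * g)
  set y := (g / (1 + g)) • x
  -- Recentring at the posterior mean `y` leaves an odd part, which integrates to zero, plus `y`
  -- times the mass.
  have e1 : ∫ θ, Real.exp (-β * ‖θ - y‖ ^ 2) • θ = ∫ u, Real.exp (-β * ‖u‖ ^ 2) • (u + y) := by
    rw [← integral_sub_right_eq_self (μ := volume)
      (fun u : EuclideanSpace ℝ (Fin d) => Real.exp (-β * ‖u‖ ^ 2) • (u + y)) y]
    simp
  have e2 : ∫ u : EuclideanSpace ℝ (Fin d), Real.exp (-β * ‖u‖ ^ 2) • u = 0 :=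
    integral_eq_zero_of_neg fun u => by simp
  simp_rw [e1, smul_add]
  rw [integral_add (integrable_exp_smul_self hβ)
    ((integrable_exp_neg_mul_sq_norm (by linarith)).smul_const y), e2, zero_add,
    integral_smul_const, integral_sub_right_eq_self (μ := volume)
    (fun θ : EuclideanSpace ℝ (Fin d) => Real.exp (-β * ‖θ‖ ^ 2)), mul_smul, mul_smul]

/-- The weight `1 + ‖θ‖` covers both the mass and the first moment. Half of the Gaussian exponent
absorbs `‖u‖`, which costs only the factor `2^(d/2)` in `integral_kernelBound`. -/
theorem gaussDensity_mul_scaleKernel_mul_le {g : ℝ} (hg : 0 < g)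
    (x θ : EuclideanSpace ℝ (Fin d)) :
    gaussDensity (x - θ) * scaleKernel g θ * (1 + ‖θ‖) ≤
      (2 * Real.pi * g) ^ (-((d : ℝ) / 2)) * ((2 + ‖x‖) *
        Real.exp (-((1 + g) / (2 * g) / 2) * ‖θ - (g / (1 + g)) • x‖ ^ 2)) := by
  have hβ := half_le_one_add_div hg
  have hπ := Real.pi_pos
  rw [gaussDensity_mul_scaleKernel hg, mul_assoc, mul_assoc]
  refine mul_le_mul_of_nonneg_left ?_ (by positivity)
  have hexp : Real.exp (-(‖x‖ ^ 2 / (2 * (1 + g)))) ≤ 1 :=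
    Real.exp_le_one_iff.2 (neg_nonpos.2 (by positivity))
  refine (mul_le_of_le_one_left (by positivity) hexp).trans ?_
  have h1 : ‖θ‖ ≤ ‖θ - (g / (1 + g)) • x‖ + ‖x‖ := by
    have h2 : ‖(g / (1 + g)) • x‖ ≤ ‖x‖ := by
      rw [norm_smul, Real.norm_of_nonneg (by positivity)]
      exact mul_le_of_le_one_left (norm_nonneg _) ((div_le_one (by linarith)).2 (by linarith))
    linarith [norm_le_norm_sub_add θ ((g / (1 + g)) • x)]
  set β := (1 + g) / (2 * g)
  set u := θ - (g / (1 + g)) • x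
  have h3 : Real.exp (-β * ‖u‖ ^ 2) ≤ Real.exp (-(β / 2) * ‖u‖ ^ 2) := by
    refine Real.exp_le_exp.2 ?_
    nlinarith [sq_nonneg ‖u‖]
  calc Real.exp (-β * ‖u‖ ^ 2) * (1 + ‖θ‖)
      ≤ Real.exp (-β * ‖u‖ ^ 2) * (1 + (‖u‖ + ‖x‖)) := by gcongr
    _ = (1 + ‖x‖) * Real.exp (-β * ‖u‖ ^ 2) + ‖u‖ * Real.exp (-β * ‖u‖ ^ 2) := by ring
    _ ≤ (1 + ‖x‖) * Real.exp (-(β / 2) * ‖u‖ ^ 2) + Real.exp (-(β / 2) * ‖u‖ ^ 2) := by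
        gcongr
        exact norm_mul_exp_le hβ u
    _ = _ := by ring

theorem integrable_kernelBound {g : ℝ} (hg : 0 < g) (x : EuclideanSpace ℝ (Fin d)) :
    Integrable fun θ => (2 * Real.pi * g) ^ (-((d : ℝ) / 2)) * ((2 + ‖x‖) *
        Real.exp (-((1 + g) / (2 * g) / 2) * ‖θ - (g / (1 + g)) • x‖ ^ 2)) :=
  (((integrable_exp_neg_mul_sq_norm (d := d)
    (by positivity : 0 < (1 + g) / (2 * g) / 2)).comp_sub_right _).const_mul _).const_mul _

theorem integral_kernelBound {g : ℝ} (hg : 0 < g) (x : EuclideanSpace ℝ (Fin d)) :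
    ∫ θ, (2 * Real.pi * g) ^ (-((d : ℝ) / 2)) * ((2 + ‖x‖) *
        Real.exp (-((1 + g) / (2 * g) / 2) * ‖θ - (g / (1 + g)) • x‖ ^ 2)) =
      2 ^ ((d : ℝ) / 2) * (2 + ‖x‖) * (g + 1) ^ (-((d : ℝ) / 2)) := by
  have h1 : 0 < g + 1 := by linarith
  have hπ := Real.pi_pos
  rw [integral_const_mul, integral_const_mul, integral_sub_right_eq_self (μ := volume)
    (fun θ : EuclideanSpace ℝ (Fin d) => Real.exp (-((1 + g) / (2 * g) / 2) * ‖θ‖ ^ 2)),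
    integral_exp_neg_mul_sq_norm (by positivity)]
  have : Real.pi / ((1 + g) / (2 * g) / 2) = 2 * (2 * Real.pi * g) / (g + 1) := by
    field_simp
    ring
  rw [this, Real.div_rpow (by positivity) h1.le, Real.mul_rpow zero_le_two (by positivity : 0 ≤ 2 * Real.pi * g),
    Real.rpow_neg (by positivity : 0 ≤ 2 * Real.pi * g), Real.rpow_neg h1.le]
  have := Real.rpow_pos_of_pos (by positivity : 0 < 2 * Real.pi * g) ((d : ℝ) / 2)
  field_simp

/-! ### Fubini over the scale: marginal density and Bayes estimator. -/

theorem mixMeasure_ae_pos (a b c : ℝ) : ∀ᵐ g ∂(mixMeasure a b c), 0 < g :=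
  (withDensity_absolutelyContinuous _ _).ae_le (ae_restrict_mem measurableSet_Ioi)

instance (a b c : ℝ) : SFinite (mixMeasure a b c) := by
  unfold mixMeasure
  infer_instance

variable {E : Type*} [NormedAddCommGroup E] [NormedSpace ℝ E]

theorem integrable_mixMeasure_iff (a b c : ℝ) (f : ℝ → E) :
    Integrable f (mixMeasure a b c) ↔ IntegrableOn (fun g => mixDensity a b c g • f g) (Ioi 0) := by
  rw [mixMeasure, integrable_withDensity_iff_integrable_smul'
    (measurable_mixDensity a b c).ennreal_ofReal (by simp)]
  exact integrable_congr ((ae_restrict_mem measurableSet_Ioi).mono fun g hg => by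
    simp [ENNReal.toReal_ofReal (mixDensity_pos a b c hg).le])

theorem integral_mixMeasure (a b c : ℝ) (f : ℝ → E) :
    ∫ g, f g ∂(mixMeasure a b c) = ∫ g in Ioi 0, mixDensity a b c g • f g := by
  rw [mixMeasure, integral_withDensity_eq_integral_toReal_smul
    (measurable_mixDensity a b c).ennreal_ofReal (by simp)]
  exact integral_congr_ae ((ae_restrict_mem measurableSet_Ioi).mono fun g hg => by
    simp [ENNReal.toReal_ofReal (mixDensity_pos a b c hg).le])

/-- The `θ`-integral of the norm is at most a multiple of `(g+1)^(-d/2)`, so integrability in `g`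
reduces to `hw`. The applications are `f = 1` and `f = id`. -/
theorem mixPrior_integrable_prod {a b c : ℝ}
    (hw : IntegrableOn (mixDensity (a - (d : ℝ) / 2) b c) (Ioi 0))
    {f : EuclideanSpace ℝ (Fin d) → E} (hf : StronglyMeasurable f) (hfb : ∀ θ, ‖f θ‖ ≤ 1 + ‖θ‖)
    (x : EuclideanSpace ℝ (Fin d)) :
    Integrable (fun p : ℝ × EuclideanSpace ℝ (Fin d) =>
      (gaussDensity (x - p.2) * scaleKernel p.1 p.2) • f p.2)
      ((mixMeasure a b c).prod volume) := by
  have hmeas : StronglyMeasurable (fun p : ℝ × EuclideanSpace ℝ (Fin d) =>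
      (gaussDensity (x - p.2) * scaleKernel p.1 p.2) • f p.2) :=
    (Measurable.stronglyMeasurable ((continuous_gaussDensity.measurable.comp
      (measurable_const.sub measurable_snd)).mul measurable_scaleKernel)).smul
      (hf.comp_measurable measurable_snd)
  have hle : ∀ g : ℝ, 0 < g → ∀ θ, ‖(gaussDensity (x - θ) * scaleKernel g θ) • f θ‖ ≤
      (2 * Real.pi * g) ^ (-((d : ℝ) / 2)) * ((2 + ‖x‖) *
        Real.exp (-((1 + g) / (2 * g) / 2) * ‖θ - (g / (1 + g)) • x‖ ^ 2)) := fun g hg θ => by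
    have hp := mul_pos (gaussDensity_pos (x - θ)) (scaleKernel_pos hg θ)
    rw [norm_smul, Real.norm_of_nonneg hp.le]
    exact (mul_le_mul_of_nonneg_left (hfb θ) hp.le).trans
      (gaussDensity_mul_scaleKernel_mul_le hg x θ)
  have hint : ∀ g : ℝ, 0 < g →
      Integrable fun θ => (gaussDensity (x - θ) * scaleKernel g θ) • f θ := fun g hg =>
    (integrable_kernelBound hg x).mono'
      (hmeas.comp_measurable measurable_prodMk_left).aestronglyMeasurable
      (Filter.Eventually.of_forall (hle g hg))
  refine (integrable_prod_iff hmeas.aestronglyMeasurable).2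
    ⟨(mixMeasure_ae_pos a b c).mono hint, ?_⟩
  have hB : Integrable (fun g : ℝ => 2 ^ ((d : ℝ) / 2) * (2 + ‖x‖) * (g + 1) ^ (-((d : ℝ) / 2)))
      (mixMeasure a b c) := by
    refine (integrable_mixMeasure_iff a b c _).2
      (IntegrableOn.congr_fun (hw.const_mul (2 ^ ((d : ℝ) / 2) * (2 + ‖x‖))) (fun g hg => ?_) measurableSet_Ioi)
    have := rpow_mul_mixDensity (-((d : ℝ) / 2)) a b c hg
    rw [neg_add_eq_sub] at this
    simp only [← this, smul_eq_mul]
    ring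
  refine hB.mono' hmeas.norm.aestronglyMeasurable.integral_prod_right'
    ((mixMeasure_ae_pos a b c).mono fun g hg => ?_)
  rw [Real.norm_of_nonneg (integral_nonneg fun _ => norm_nonneg _), ← integral_kernelBound hg x]
  exact integral_mono (hint g hg).norm (integrable_kernelBound hg x) (hle g hg)

theorem smul_ofReal_scaleKernel_ae (a b c : ℝ) (x : EuclideanSpace ℝ (Fin d))
    (f : EuclideanSpace ℝ (Fin d) → E) :
    (fun p : ℝ × EuclideanSpace ℝ (Fin d) => (ENNReal.ofReal (scaleKernel p.1 p.2)).toReal •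
      gaussDensity (x - p.2) • f p.2) =ᵐ[(mixMeasure a b c).prod volume]
    fun p => (gaussDensity (x - p.2) * scaleKernel p.1 p.2) • f p.2 := by
  have : ∀ᵐ p ∂((mixMeasure a b c).prod (volume : Measure (EuclideanSpace ℝ (Fin d)))),
      0 < p.1 := Measure.quasiMeasurePreserving_fst.ae (mixMeasure_ae_pos a b c)
  filter_upwards [this] with p hp
  rw [ENNReal.toReal_ofReal (scaleKernel_pos hp _).le, smul_smul, mul_comm]

theorem integrable_mixPrior {a b c : ℝ}
    (hw : IntegrableOn (mixDensity (a - (d : ℝ) / 2) b c) (Ioi 0))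
    {f : EuclideanSpace ℝ (Fin d) → E} (hf : StronglyMeasurable f) (hfb : ∀ θ, ‖f θ‖ ≤ 1 + ‖θ‖)
    (x : EuclideanSpace ℝ (Fin d)) :
    Integrable (fun θ => gaussDensity (x - θ) • f θ) (mixPrior d (mixMeasure a b c)) := by
  have hF : StronglyMeasurable fun θ => gaussDensity (x - θ) • f θ :=
    (continuous_gaussDensity.comp (continuous_const.sub continuous_id)).stronglyMeasurable.smul hf
  rw [mixPrior_eq_map, integrable_map_measure hF.aestronglyMeasurable measurable_snd.aemeasurable,
    integrable_withDensity_iff_integrable_smul' measurable_scaleKernel.ennreal_ofReal (by simp)]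
  exact (mixPrior_integrable_prod hw hf hfb x).congr (smul_ofReal_scaleKernel_ae a b c x f).symm

theorem integral_mixPrior {a b c : ℝ}
    (hw : IntegrableOn (mixDensity (a - (d : ℝ) / 2) b c) (Ioi 0))
    {f : EuclideanSpace ℝ (Fin d) → E} (hf : StronglyMeasurable f) (hfb : ∀ θ, ‖f θ‖ ≤ 1 + ‖θ‖)
    (x : EuclideanSpace ℝ (Fin d)) :
    ∫ θ, gaussDensity (x - θ) • f θ ∂(mixPrior d (mixMeasure a b c)) =
      ∫ g in Ioi 0, mixDensity a b c g • ∫ θ, (gaussDensity (x - θ) * scaleKernel g θ) • f θ := by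
  have hF : StronglyMeasurable fun θ => gaussDensity (x - θ) • f θ :=
    (continuous_gaussDensity.comp (continuous_const.sub continuous_id)).stronglyMeasurable.smul hf
  rw [mixPrior_eq_map, integral_map measurable_snd.aemeasurable hF.aestronglyMeasurable,
    integral_withDensity_eq_integral_toReal_smul measurable_scaleKernel.ennreal_ofReal (by simp),
    integral_congr_ae (smul_ofReal_scaleKernel_ae a b c x f),
    integral_prod _ (mixPrior_integrable_prod hw hf hfb x), integral_mixMeasure]

theorem integrable_gaussDensity_mixPrior {a b c : ℝ}
    (hw : IntegrableOn (mixDensity (a - (d : ℝ) / 2) b c) (Ioi 0))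
    (x : EuclideanSpace ℝ (Fin d)) :
    Integrable (fun θ => gaussDensity (x - θ)) (mixPrior d (mixMeasure a b c)) := by
  simpa using integrable_mixPrior hw (stronglyMeasurable_const (b := (1 : ℝ))) (by simp) x

theorem integrable_gaussDensity_smul_mixPrior {a b c : ℝ}
    (hw : IntegrableOn (mixDensity (a - (d : ℝ) / 2) b c) (Ioi 0))
    (x : EuclideanSpace ℝ (Fin d)) :
    Integrable (fun θ => gaussDensity (x - θ) • θ) (mixPrior d (mixMeasure a b c)) :=
  integrable_mixPrior hw stronglyMeasurable_id (by simp) x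

theorem marginal_mixPrior {a b c : ℝ}
    (hw : IntegrableOn (mixDensity (a - (d : ℝ) / 2) b c) (Ioi 0))
    (x : EuclideanSpace ℝ (Fin d)) :
    marginal (mixPrior d (mixMeasure a b c)) x =
      expTransform (mixDensity (a - (d : ℝ) / 2) b c) (‖x‖ ^ 2) := by
  have := integral_mixPrior hw (stronglyMeasurable_const (b := (1 : ℝ))) (by simp) x
  simp only [smul_eq_mul, mul_one] at this
  rw [marginal, this, expTransform]
  refine setIntegral_congr_fun measurableSet_Ioi fun g hg => ?_
  have e := rpow_mul_mixDensity (-((d : ℝ) / 2)) a b c hg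
  rw [neg_add_eq_sub] at e
  simp only [integral_gaussDensity_mul_scaleKernel hg x, ← e]
  ring

/-- The posterior mean given `g` has factor `g/(1+g) = 1 - 1/(1+g)`; averaging over `g` produces the
ratio of transforms. -/
theorem genBayes_mixPrior {a b c : ℝ}
    (hw : IntegrableOn (mixDensity (a - (d : ℝ) / 2) b c) (Ioi 0))
    (x : EuclideanSpace ℝ (Fin d)) :
    genBayes (mixPrior d (mixMeasure a b c)) x =
      (1 - expTransform (fun g => mixDensity (a - (d : ℝ) / 2) b c g / (1 + g)) (‖x‖ ^ 2) /
        expTransform (mixDensity (a - (d : ℝ) / 2) b c) (‖x‖ ^ 2)) • x := by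
  have hpos := expTransform_pos hw (fun g hg => mixDensity_pos _ b c hg) (‖x‖ ^ 2)
  have hint := integral_mixPrior hw stronglyMeasurable_id (by simp) x
  simp only [id] at hint
  rw [genBayes, marginal_mixPrior hw, hint,
    inv_smul_eq_iff₀ hpos.ne', smul_smul, mul_sub, mul_one, mul_div_cancel₀ _ hpos.ne']
  rw [expTransform, expTransform, ← integral_sub (integrableOn_expTransform hw _)
    (integrableOn_expTransform (integrableOn_div_one_add hw) _), ← integral_smul_const]
  refine setIntegral_congr_fun measurableSet_Ioi fun g hg => ?_
  have e := rpow_mul_mixDensity (-((d : ℝ) / 2)) a b c hg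
  rw [neg_add_eq_sub] at e
  have hg : (0 : ℝ) < g := hg
  simp only [integral_gaussDensity_mul_scaleKernel_smul hg x, ← e, smul_smul]
  congr 1
  field_simp
  ring

/-! ### Risk integrals and Stein's identity for radial fields. -/

/-- Growth up to `exp(‖x‖²/4)` uses half of the Gaussian exponent and leaves a Gaussian centred at
`2θ`. -/
theorem gaussDensity_sub_mul_exp (x θ : EuclideanSpace ℝ (Fin d)) :
    gaussDensity (x - θ) * Real.exp (‖x‖ ^ 2 / 4) = 1 / (2 * Real.pi) ^ ((d : ℝ) / 2) *
      Real.exp (‖θ‖ ^ 2 / 2) * Real.exp (-(1 / 4) * ‖x - (2 : ℝ) • θ‖ ^ 2) := by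
  unfold gaussDensity
  rw [mul_assoc, ← Real.exp_add, mul_assoc, ← Real.exp_add, norm_sub_sq_real, norm_sub_sq_real,
    inner_smul_right, norm_smul, mul_pow, Real.norm_of_nonneg zero_le_two]
  congr 2
  ring

theorem integrable_gaussDensity_mul {F : EuclideanSpace ℝ (Fin d) → ℝ} (hF : Continuous F)
    {A : ℝ} (hA : ∀ x, |F x| ≤ A * Real.exp (‖x‖ ^ 2 / 4)) (θ : EuclideanSpace ℝ (Fin d)) :
    Integrable fun x => gaussDensity (x - θ) * F x := by
  have hG : Integrable fun x => gaussDensity (x - θ) * Real.exp (‖x‖ ^ 2 / 4) := by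
    simp_rw [gaussDensity_sub_mul_exp]
    exact ((integrable_exp_neg_mul_sq_norm (by norm_num)).comp_sub_right _).const_mul _
  have hc : Continuous fun x : EuclideanSpace ℝ (Fin d) => gaussDensity (x - θ) :=
    continuous_gaussDensity.comp (by fun_prop)
  refine (hG.const_mul A).mono' (hc.mul hF).aestronglyMeasurable
    (Filter.Eventually.of_forall fun x => ?_)
  rw [norm_mul, Real.norm_of_nonneg (gaussDensity_pos _).le, Real.norm_eq_abs, mul_left_comm]
  exact mul_le_mul_of_nonneg_left (hA x) (gaussDensity_pos _).le

theorem risk_eq_ofReal {δ : EuclideanSpace ℝ (Fin d) → EuclideanSpace ℝ (Fin d)}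
    {θ : EuclideanSpace ℝ (Fin d)} (h : Integrable fun x => gaussDensity (x - θ) * ‖δ x - θ‖ ^ 2) :
    risk δ θ = ENNReal.ofReal (∫ x, gaussDensity (x - θ) * ‖δ x - θ‖ ^ 2) := by
  have hc : Continuous fun x : EuclideanSpace ℝ (Fin d) => gaussDensity (x - θ) :=
    continuous_gaussDensity.comp (by fun_prop)
  rw [risk, sampling, lintegral_withDensity_eq_lintegral_mul_non_measurable _
    hc.measurable.ennreal_ofReal (by simp), ofReal_integral_eq_lintegral_ofReal h
    (Filter.Eventually.of_forall fun x => mul_nonneg (gaussDensity_pos _).le (sq_nonneg _))]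
  exact lintegral_congr fun x => (ENNReal.ofReal_mul (gaussDensity_pos _).le).symm

theorem sq_norm_le_exp {E : Type*} [NormedAddCommGroup E] (x : E) :
    ‖x‖ ^ 2 ≤ 8 * Real.exp (‖x‖ ^ 2 / 8) := by
  linarith [Real.add_one_le_exp (‖x‖ ^ 2 / 8)]

theorem hasFDerivAt_gaussDensity_sub (x θ : EuclideanSpace ℝ (Fin d)) :
    HasFDerivAt (fun x => gaussDensity (x - θ)) (-(gaussDensity (x - θ)) • innerSL ℝ (x - θ)) x := by
  have h1 : HasFDerivAt (fun x : EuclideanSpace ℝ (Fin d) => ‖x - θ‖ ^ 2)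
      (2 • innerSL ℝ (x - θ)) x := by
    simpa using ((hasFDerivAt_id x).sub_const θ).norm_sq
  have h2 := ((((h1.const_mul (1 / 2)).neg).exp).const_mul (1 / (2 * Real.pi) ^ ((d : ℝ) / 2)))
  have e : (fun x : EuclideanSpace ℝ (Fin d) => gaussDensity (x - θ)) = fun x =>
      1 / (2 * Real.pi) ^ ((d : ℝ) / 2) * Real.exp (-(1 / 2 * ‖x - θ‖ ^ 2)) := by
    ext x
    simp only [gaussDensity]
    ring_nf
  rw [e]
  refine h2.congr_fderiv ?_
  ext v
  simp [gaussDensity]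
  ring_nf

section Radial

variable {h h' : ℝ → ℝ} {C : ℝ}

theorem hasFDerivAt_comp_sq_norm (hh : ∀ t, 0 ≤ t → HasDerivAt h (h' t) t)
    (x : EuclideanSpace ℝ (Fin d)) :
    HasFDerivAt (fun x => h (‖x‖ ^ 2)) ((2 * h' (‖x‖ ^ 2)) • innerSL ℝ x) x := by
  have h1 : HasFDerivAt (fun x : EuclideanSpace ℝ (Fin d) => ‖x‖ ^ 2) (2 • innerSL ℝ x) x := by
    simpa using (hasFDerivAt_id x).norm_sq
  refine ((hh _ (sq_nonneg ‖x‖)).comp_hasFDerivAt x h1).congr_fderiv ?_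
  ext v
  simp
  ring

theorem continuous_comp_sq_norm (hh : ContinuousOn h (Ici 0)) :
    Continuous fun x : EuclideanSpace ℝ (Fin d) => h (‖x‖ ^ 2) :=
  hh.comp_continuous (by fun_prop) fun x => sq_nonneg ‖x‖

theorem abs_apply_le (x : EuclideanSpace ℝ (Fin d)) (i : Fin d) : |x i| ≤ ‖x‖ :=
  PiLp.norm_apply_le x i

theorem exp_div_sixteen_mul (t : ℝ) :
    Real.exp (t / 16) * Real.exp (t / 8) = Real.exp (t * (3 / 16)) := by
  rw [← Real.exp_add]
  ring_nf

/-- **Stein's identity** for the radial field `x ↦ h(‖x‖²) x`. -/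
theorem integral_stein_radial (hh : ∀ t, 0 ≤ t → HasDerivAt h (h' t) t)
    (hc : ContinuousOn h' (Ici 0)) (hb : ∀ t, 0 ≤ t → |h t| ≤ C * Real.exp (t / 16))
    (hb' : ∀ t, 0 ≤ t → |h' t| ≤ C * Real.exp (t / 16)) (θ : EuclideanSpace ℝ (Fin d)) :
    Integrable (fun x => gaussDensity (x - θ) * (h (‖x‖ ^ 2) * inner ℝ x (x - θ))) ∧
    Integrable (fun x => gaussDensity (x - θ) *
      (d * h (‖x‖ ^ 2) + 2 * ‖x‖ ^ 2 * h' (‖x‖ ^ 2))) ∧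
    ∫ x, gaussDensity (x - θ) * (h (‖x‖ ^ 2) * inner ℝ x (x - θ)) =
      ∫ x, gaussDensity (x - θ) * (d * h (‖x‖ ^ 2) + 2 * ‖x‖ ^ 2 * h' (‖x‖ ^ 2)) := by
  have hC : 0 ≤ C := by simpa using (abs_nonneg _).trans (hb 0 le_rfl)
  have hcont : Continuous fun x : EuclideanSpace ℝ (Fin d) => h (‖x‖ ^ 2) :=
    continuous_comp_sq_norm fun t ht => (hh t ht).continuousAt.continuousWithinAt
  have hcont' : Continuous fun x : EuclideanSpace ℝ (Fin d) => h' (‖x‖ ^ 2) :=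
    continuous_comp_sq_norm hc
  have hexp : ∀ x : EuclideanSpace ℝ (Fin d), Real.exp (‖x‖ ^ 2 / 16) * Real.exp (‖x‖ ^ 2 / 8) ≤
      Real.exp (‖x‖ ^ 2 / 4) := fun x => by
    rw [exp_div_sixteen_mul]
    exact Real.exp_le_exp.2 (by nlinarith [sq_nonneg ‖x‖])
  have hone : ∀ x : EuclideanSpace ℝ (Fin d), 1 ≤ Real.exp (‖x‖ ^ 2 / 8) := fun x =>
    Real.one_le_exp (by positivity)
  -- Growth budget: `1/16` for `h` or `h'` and `1/8` for a polynomial factor add up to `3/16 ≤ 1/4`.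
  have key : ∀ {p : EuclideanSpace ℝ (Fin d) → ℝ} {B : ℝ}, Continuous p →
      (∀ x, |p x| ≤ B * Real.exp (‖x‖ ^ 2 / 8)) →
      Integrable (fun x => gaussDensity (x - θ) * (h (‖x‖ ^ 2) * p x)) ∧
      Integrable (fun x => gaussDensity (x - θ) * (h' (‖x‖ ^ 2) * p x)) := by
    intro p B hp hpB
    have hB : 0 ≤ B := by simpa using (abs_nonneg _).trans (hpB 0)
    have : ∀ k : ℝ → ℝ, (∀ t, 0 ≤ t → |k t| ≤ C * Real.exp (t / 16)) →
        ∀ x : EuclideanSpace ℝ (Fin d),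
          |k (‖x‖ ^ 2) * p x| ≤ C * B * Real.exp (‖x‖ ^ 2 / 4) := fun k hk x => by
      rw [abs_mul]
      calc |k (‖x‖ ^ 2)| * |p x|
          ≤ (C * Real.exp (‖x‖ ^ 2 / 16)) * (B * Real.exp (‖x‖ ^ 2 / 8)) :=
            mul_le_mul (hk _ (sq_nonneg _)) (hpB x) (abs_nonneg _) (by positivity)
        _ = C * B * (Real.exp (‖x‖ ^ 2 / 16) * Real.exp (‖x‖ ^ 2 / 8)) := by ring
        _ ≤ _ := mul_le_mul_of_nonneg_left (hexp x) (by positivity)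
    exact ⟨integrable_gaussDensity_mul (hcont.mul hp) (this h hb) θ,
      integrable_gaussDensity_mul (hcont'.mul hp) (this h' hb') θ⟩
  have habs : ∀ (x : EuclideanSpace ℝ (Fin d)) (i : Fin d), |x i| ≤ 8 * Real.exp (‖x‖ ^ 2 / 8) :=
    fun x i => by
      have := abs_apply_le x i
      nlinarith [sq_norm_le_exp x, hone x, sq_nonneg (‖x‖ - 1), norm_nonneg x]
  have hsq : ∀ (x : EuclideanSpace ℝ (Fin d)) (i : Fin d),
      |x i ^ 2| ≤ 8 * Real.exp (‖x‖ ^ 2 / 8) := fun x i => by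
    rw [abs_pow]
    exact (pow_le_pow_left₀ (abs_nonneg _) (abs_apply_le x i) 2).trans (sq_norm_le_exp x)
  have hprod : ∀ (x : EuclideanSpace ℝ (Fin d)) (i : Fin d),
      |x i * (x - θ) i| ≤ (16 + ‖θ‖ ^ 2) * Real.exp (‖x‖ ^ 2 / 8) := fun x i => by
    rw [abs_mul]
    have h1 := mul_le_mul (abs_apply_le x i) ((abs_apply_le (x - θ) i).trans (norm_sub_le x θ))
      (abs_nonneg _) (norm_nonneg x)
    nlinarith [sq_norm_le_exp x, hone x, sq_nonneg (‖x‖ - ‖θ‖), norm_nonneg x, norm_nonneg θ,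
      mul_le_mul_of_nonneg_left (hone x) (sq_nonneg ‖θ‖)]
  have hcoord : ∀ i : Fin d, Continuous fun x : EuclideanSpace ℝ (Fin d) => x i := fun i => by
    fun_prop
  have I1 : ∀ i : Fin d, Integrable fun x : EuclideanSpace ℝ (Fin d) =>
      gaussDensity (x - θ) * (h (‖x‖ ^ 2) * (x i * (x - θ) i)) := fun i =>
    (key ((hcoord i).mul ((hcoord i).comp (by fun_prop))) fun x => hprod x i).1
  have I2 : ∀ i : Fin d, Integrable fun x : EuclideanSpace ℝ (Fin d) =>
      gaussDensity (x - θ) * (h (‖x‖ ^ 2) + 2 * x i ^ 2 * h' (‖x‖ ^ 2)) := fun i => by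
    refine ((key (p := fun _ => 1) (B := 1) continuous_const (by simpa using hone)).1.add
      ((key ((hcoord i).pow 2) fun x => hsq x i).2.const_mul 2)).congr
      (Filter.Eventually.of_forall fun x => ?_)
    simp only [Pi.add_apply, Pi.pow_apply]
    ring
  have I3 : ∀ i : Fin d, Integrable fun x : EuclideanSpace ℝ (Fin d) =>
      gaussDensity (x - θ) * (h (‖x‖ ^ 2) * x i) := fun i =>
    (key (hcoord i) fun x => habs x i).1
  -- Integration by parts in direction `i`, using `∂ᵢ φ(x-θ) = -(x-θ)ᵢ φ(x-θ)`; summing over `i`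
  -- gives the divergence of the field.
  have S : ∀ i : Fin d, ∫ x : EuclideanSpace ℝ (Fin d),
      gaussDensity (x - θ) * (h (‖x‖ ^ 2) * (x i * (x - θ) i)) =
      ∫ x : EuclideanSpace ℝ (Fin d),
        gaussDensity (x - θ) * (h (‖x‖ ^ 2) + 2 * x i ^ 2 * h' (‖x‖ ^ 2)) := fun i => by
    have hf : ∀ x : EuclideanSpace ℝ (Fin d), HasFDerivAt (fun x => h (‖x‖ ^ 2) * x i)
        (h (‖x‖ ^ 2) • (EuclideanSpace.proj i : EuclideanSpace ℝ (Fin d) →L[ℝ] ℝ) +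
          x i • ((2 * h' (‖x‖ ^ 2)) • innerSL ℝ x)) x := fun x =>
      (hasFDerivAt_comp_sq_norm hh x).mul
        (EuclideanSpace.proj i : EuclideanSpace ℝ (Fin d) →L[ℝ] ℝ).hasFDerivAt
    have e1 : ∀ x : EuclideanSpace ℝ (Fin d),
        inner ℝ x (EuclideanSpace.single i (1 : ℝ)) = x i := fun x => by
      rw [EuclideanSpace.inner_single_right]
      simp
    have := integral_bilinear_hasFDerivAt_right_eq_neg_left_of_integrable
      (μ := (volume : Measure (EuclideanSpace ℝ (Fin d)))) (B := ContinuousLinearMap.mul ℝ ℝ)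
      (v := EuclideanSpace.single i (1 : ℝ)) (f := fun x => h (‖x‖ ^ 2) * x i)
      (g := fun x => gaussDensity (x - θ)) ?_ ?_ ?_ (fun x _ => hf x)
      (fun x _ => hasFDerivAt_gaussDensity_sub x θ)
    · rw [← neg_inj, ← integral_neg, ← integral_neg]
      rw [← integral_neg] at this
      refine (integral_congr_ae (Filter.Eventually.of_forall fun x => ?_)).trans
        (this.trans (integral_congr_ae (Filter.Eventually.of_forall fun x => ?_)))
      · simp [e1]
        ring
      · simp [e1]
        ring
    · refine (I2 i).congr (Filter.Eventually.of_forall fun x => ?_)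
      simp [e1]
      ring
    · refine (I1 i).neg.congr (Filter.Eventually.of_forall fun x => ?_)
      simp [e1]
      ring
    · refine (I3 i).congr (Filter.Eventually.of_forall fun x => ?_)
      simp
      ring
  have E1 : (fun x : EuclideanSpace ℝ (Fin d) =>
      gaussDensity (x - θ) * (h (‖x‖ ^ 2) * inner ℝ x (x - θ))) = fun x =>
      ∑ i, gaussDensity (x - θ) * (h (‖x‖ ^ 2) * (x i * (x - θ) i)) := by
    ext x
    rw [← Finset.mul_sum, ← Finset.mul_sum, PiLp.inner_apply]
    simp [mul_comm]
  have E2 : (fun x : EuclideanSpace ℝ (Fin d) => gaussDensity (x - θ) *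
      (d * h (‖x‖ ^ 2) + 2 * ‖x‖ ^ 2 * h' (‖x‖ ^ 2))) = fun x =>
      ∑ i, gaussDensity (x - θ) * (h (‖x‖ ^ 2) + 2 * x i ^ 2 * h' (‖x‖ ^ 2)) := by
    ext x
    rw [← Finset.mul_sum, Finset.sum_add_distrib, ← Finset.sum_mul, ← Finset.mul_sum,
      ← EuclideanSpace.real_norm_sq_eq]
    simp
  rw [E1, E2]
  refine ⟨integrable_finsetSum _ fun i _ => I1 i, integrable_finsetSum _ fun i _ => I2 i, ?_⟩
  rw [integral_finsetSum _ fun i _ => I1 i, integral_finsetSum _ fun i _ => I2 i]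
  exact Finset.sum_congr rfl fun i _ => S i

/-- A radial shrinkage estimator is improved by the field `-h(‖x‖²) x` when the unbiased estimate
of the difference of risks is negative. -/
theorem risk_lt_of_radial {r : ℝ → ℝ} (hr : ContinuousOn r (Ici 0))
    (hr0 : ∀ t, 0 ≤ t → 0 ≤ r t) (hr1 : ∀ t, 0 ≤ t → r t ≤ 1)
    (hh : ∀ t, 0 ≤ t → HasDerivAt h (h' t) t)
    (hc : ContinuousOn h' (Ici 0)) (hb : ∀ t, 0 ≤ t → |h t| ≤ C * Real.exp (t / 16))
    (hb' : ∀ t, 0 ≤ t → |h' t| ≤ C * Real.exp (t / 16))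
    (hneg : ∀ t, 0 ≤ t → t * h t ^ 2 + 2 * t * h t * r t < 2 * (d * h t + 2 * t * h' t))
    (θ : EuclideanSpace ℝ (Fin d)) :
    risk (fun x => (1 - r (‖x‖ ^ 2)) • x - h (‖x‖ ^ 2) • x) θ <
      risk (fun x => (1 - r (‖x‖ ^ 2)) • x) θ := by
  have hC : 0 ≤ C := by simpa using (abs_nonneg _).trans (hb 0 le_rfl)
  have hcont : Continuous fun x : EuclideanSpace ℝ (Fin d) => h (‖x‖ ^ 2) :=
    continuous_comp_sq_norm fun t ht => (hh t ht).continuousAt.continuousWithinAt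
  have hcontr : Continuous fun x : EuclideanSpace ℝ (Fin d) => r (‖x‖ ^ 2) :=
    continuous_comp_sq_norm hr
  have hnsq : Continuous fun x : EuclideanSpace ℝ (Fin d) => ‖x‖ ^ 2 := by fun_prop
  obtain ⟨J1, J2, JE⟩ := integral_stein_radial hh hc hb hb' θ
  have J0 : Integrable fun x : EuclideanSpace ℝ (Fin d) =>
      gaussDensity (x - θ) * ‖(1 - r (‖x‖ ^ 2)) • x - θ‖ ^ 2 := by
    refine integrable_gaussDensity_mul (A := 16 + 2 * ‖θ‖ ^ 2)
      ((((continuous_const.sub hcontr).smul continuous_id).sub continuous_const).norm.pow 2) (fun x => ?_) θ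
    have h1 : ‖(1 - r (‖x‖ ^ 2)) • x‖ ≤ ‖x‖ := by
      rw [norm_smul, Real.norm_of_nonneg (by linarith [hr1 _ (sq_nonneg ‖x‖)])]
      exact mul_le_of_le_one_left (norm_nonneg _) (by linarith [hr0 _ (sq_nonneg ‖x‖)])
    have h2 : ‖(1 - r (‖x‖ ^ 2)) • x - θ‖ ≤ ‖x‖ + ‖θ‖ := (norm_sub_le _ _).trans (by linarith)
    have h3 : Real.exp (‖x‖ ^ 2 / 8) ≤ Real.exp (‖x‖ ^ 2 / 4) :=
      Real.exp_le_exp.2 (by linarith [sq_nonneg ‖x‖])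
    have h4 : 1 ≤ Real.exp (‖x‖ ^ 2 / 4) := Real.one_le_exp (by positivity)
    rw [abs_of_nonneg (sq_nonneg _)]
    refine (pow_le_pow_left₀ (norm_nonneg _) h2 2).trans ?_
    nlinarith [sq_norm_le_exp x, sq_nonneg (‖x‖ - ‖θ‖),
      mul_le_mul_of_nonneg_left h4 (sq_nonneg ‖θ‖)]
  have J3 : Integrable fun x : EuclideanSpace ℝ (Fin d) => gaussDensity (x - θ) *
      (‖x‖ ^ 2 * h (‖x‖ ^ 2) ^ 2 + 2 * ‖x‖ ^ 2 * h (‖x‖ ^ 2) * r (‖x‖ ^ 2)) := by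
    refine integrable_gaussDensity_mul (A := 8 * C ^ 2 + 16 * C)
      (F := fun x => ‖x‖ ^ 2 * h (‖x‖ ^ 2) ^ 2 + 2 * ‖x‖ ^ 2 * h (‖x‖ ^ 2) * r (‖x‖ ^ 2))
      ((hnsq.mul (hcont.pow 2)).add (((continuous_const.mul hnsq).mul hcont).mul hcontr)) (fun x => ?_) θ
    have ht := sq_norm_le_exp x
    have hbx := hb _ (sq_nonneg ‖x‖)
    have hrx0 := hr0 _ (sq_nonneg ‖x‖)
    have hrx1 := hr1 _ (sq_nonneg ‖x‖)
    have hE : 1 ≤ Real.exp (‖x‖ ^ 2 / 16) := Real.one_le_exp (by positivity)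
    have e1 : Real.exp (‖x‖ ^ 2 / 8) = Real.exp (‖x‖ ^ 2 / 16) ^ 2 := by
      rw [← Real.exp_nat_mul]
      congr 1
      push_cast
      ring
    have e2 : Real.exp (‖x‖ ^ 2 / 4) = Real.exp (‖x‖ ^ 2 / 16) ^ 4 := by
      rw [← Real.exp_nat_mul]
      congr 1
      push_cast
      ring
    rw [e1] at ht
    rw [e2]
    set e := Real.exp (‖x‖ ^ 2 / 16)
    refine (abs_add_le _ _).trans ?_
    rw [abs_mul, abs_mul, abs_mul, abs_mul, abs_of_nonneg (sq_nonneg ‖x‖),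
      abs_pow, abs_of_nonneg hrx0, abs_two]
    have k1 : ‖x‖ ^ 2 * |h (‖x‖ ^ 2)| ^ 2 ≤ (8 * e ^ 2) * (C * e) ^ 2 := by gcongr
    have k2 : 2 * ‖x‖ ^ 2 * |h (‖x‖ ^ 2)| * r (‖x‖ ^ 2) ≤ 2 * (8 * e ^ 2) * (C * e) * 1 := by
      gcongr
    have k3 : e ^ 3 ≤ e ^ 4 := pow_le_pow_right₀ hE (by norm_num)
    nlinarith [mul_le_mul_of_nonneg_left k3 hC]
  have hexpand : ∀ x : EuclideanSpace ℝ (Fin d), gaussDensity (x - θ) *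
      ‖(1 - r (‖x‖ ^ 2)) • x - h (‖x‖ ^ 2) • x - θ‖ ^ 2 =
      gaussDensity (x - θ) * ‖(1 - r (‖x‖ ^ 2)) • x - θ‖ ^ 2 +
      (gaussDensity (x - θ) *
        (‖x‖ ^ 2 * h (‖x‖ ^ 2) ^ 2 + 2 * ‖x‖ ^ 2 * h (‖x‖ ^ 2) * r (‖x‖ ^ 2)) -
      2 * (gaussDensity (x - θ) * (h (‖x‖ ^ 2) * inner ℝ x (x - θ)))) := fun x => by
    have e1 : (1 - r (‖x‖ ^ 2)) • x - h (‖x‖ ^ 2) • x - θ =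
        ((1 - r (‖x‖ ^ 2)) • x - θ) - h (‖x‖ ^ 2) • x := by abel
    have e2 : ∀ s : ℝ, s • x - θ = (x - θ) - (1 - s) • x := fun s => by
      rw [sub_smul, one_smul]
      abel
    rw [e1, norm_sub_sq_real ((1 - r (‖x‖ ^ 2)) • x - θ), e2, inner_sub_left, inner_smul_right,
      inner_smul_right, inner_smul_left, norm_smul, mul_pow, Real.norm_eq_abs, sq_abs,
      real_inner_self_eq_norm_sq, real_inner_comm]
    simp
    ring
  have K : Integrable fun x : EuclideanSpace ℝ (Fin d) => gaussDensity (x - θ) *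
        (‖x‖ ^ 2 * h (‖x‖ ^ 2) ^ 2 + 2 * ‖x‖ ^ 2 * h (‖x‖ ^ 2) * r (‖x‖ ^ 2)) -
      2 * (gaussDensity (x - θ) * (h (‖x‖ ^ 2) * inner ℝ x (x - θ))) := J3.sub (J1.const_mul 2)
  have J4 : Integrable fun x : EuclideanSpace ℝ (Fin d) => gaussDensity (x - θ) *
      ‖(1 - r (‖x‖ ^ 2)) • x - h (‖x‖ ^ 2) • x - θ‖ ^ 2 := by
    simp_rw [hexpand]
    exact J0.add K
  have hlt : ∫ x : EuclideanSpace ℝ (Fin d), gaussDensity (x - θ) *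
      ‖(1 - r (‖x‖ ^ 2)) • x - h (‖x‖ ^ 2) • x - θ‖ ^ 2 <
      ∫ x, gaussDensity (x - θ) * ‖(1 - r (‖x‖ ^ 2)) • x - θ‖ ^ 2 := by
    simp_rw [hexpand]
    -- Stein's identity `JE` removes the explicit `θ` from the cross term, so the sign can be
    -- decided pointwise by `hneg`.
    rw [integral_add J0 K, integral_sub J3 (J1.const_mul 2), integral_const_mul, JE,
      ← integral_const_mul]
    have hp : 0 < ∫ x : EuclideanSpace ℝ (Fin d), (2 * (gaussDensity (x - θ) *
        (d * h (‖x‖ ^ 2) + 2 * ‖x‖ ^ 2 * h' (‖x‖ ^ 2))) - gaussDensity (x - θ) *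
        (‖x‖ ^ 2 * h (‖x‖ ^ 2) ^ 2 + 2 * ‖x‖ ^ 2 * h (‖x‖ ^ 2) * r (‖x‖ ^ 2))) := by
      have hpt : ∀ x : EuclideanSpace ℝ (Fin d), 0 < 2 * (gaussDensity (x - θ) *
        (d * h (‖x‖ ^ 2) + 2 * ‖x‖ ^ 2 * h' (‖x‖ ^ 2))) - gaussDensity (x - θ) *
        (‖x‖ ^ 2 * h (‖x‖ ^ 2) ^ 2 + 2 * ‖x‖ ^ 2 * h (‖x‖ ^ 2) * r (‖x‖ ^ 2)) := fun x => by
        have := mul_lt_mul_of_pos_left (hneg _ (sq_nonneg ‖x‖)) (gaussDensity_pos (x - θ))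
        linarith
      rw [integral_pos_iff_support_of_nonneg (fun x => (hpt x).le) ((J2.const_mul 2).sub J3)]
      have : Function.support (fun x : EuclideanSpace ℝ (Fin d) => 2 * (gaussDensity (x - θ) *
        (d * h (‖x‖ ^ 2) + 2 * ‖x‖ ^ 2 * h' (‖x‖ ^ 2))) - gaussDensity (x - θ) *
        (‖x‖ ^ 2 * h (‖x‖ ^ 2) ^ 2 + 2 * ‖x‖ ^ 2 * h (‖x‖ ^ 2) * r (‖x‖ ^ 2))) = univ :=
        eq_univ_of_forall fun x => (hpt x).ne'
      rw [this]
      exact NeZero.pos _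
    rw [integral_sub (J2.const_mul 2) J3] at hp
    linarith
  rw [risk_eq_ofReal J4, risk_eq_ofReal J0]
  refine (ENNReal.ofReal_lt_ofReal_iff (lt_of_le_of_lt ?_ hlt)).2 hlt
  exact integral_nonneg fun x => mul_nonneg (gaussDensity_pos _).le (sq_nonneg _)

end Radial

/-! ### The dominating estimator. -/

/-- If Brown's integral converges, the generalized Bayes estimator is dominated by
`δ_π(x) - x / ((1 + ‖x‖²)^(d/2) G(‖x‖²) m(‖x‖²))`, where `m` is the marginal density and
`G(t) = 1 + ∫_t^∞ ds / (4 (1 + s)^(d/2) m(s))`. -/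
theorem exists_dominating_radial (hd : 0 < d) {w : ℝ → ℝ} (hw : IntegrableOn w (Ioi 0))
    (h0 : ∀ g, 0 < g → 0 < w g)
    (hB : IntegrableOn (fun t : ℝ => 1 / (t ^ ((d : ℝ) / 2) * expTransform w t)) (Ioi 1)) :
    ∃ h : ℝ → ℝ, ContinuousOn h (Ici 0) ∧ ∀ θ : EuclideanSpace ℝ (Fin d),
      risk (fun x => (1 - expTransform (fun g => w g / (1 + g)) (‖x‖ ^ 2) /
        expTransform w (‖x‖ ^ 2)) • x - h (‖x‖ ^ 2) • x) θ <
      risk (fun x => (1 - expTransform (fun g => w g / (1 + g)) (‖x‖ ^ 2) /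
        expTransform w (‖x‖ ^ 2)) • x) θ := by
  have hw1 := integrableOn_div_one_add hw
  have h01 : ∀ g : ℝ, 0 < g → 0 < w g / (1 + g) := fun g hg => div_pos (h0 g hg) (by linarith)
  set m := expTransform w
  set r : ℝ → ℝ := fun t => expTransform (fun g => w g / (1 + g)) t / m t with hr_def
  have hm : ∀ t, 0 < m t := expTransform_pos hw h0
  have hmc : Continuous m := continuous_expTransform hw
  have hrc : Continuous r := (continuous_expTransform hw1).div hmc fun t => (hm t).ne'
  have hr0 : ∀ t, 0 ≤ r t := fun t => (div_pos (expTransform_pos hw1 h01 t) (hm t)).le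
  have hr1 : ∀ t, r t ≤ 1 := fun t =>
    (div_le_one (hm t)).2 (expTransform_div_one_add_le hw h0 t)
  have hmd : ∀ t, HasDerivAt m (-(m t * r t / 2)) t := fun t => by
    rw [hr_def]
    simp only
    rw [mul_div_cancel₀ _ (hm t).ne']
    exact hasDerivAt_expTransform hw t
  -- The rate is `1/32` because `h'` contains `P⁻²`, whose growth must stay within `exp(t/16)`.
  obtain ⟨C, hC, hCle⟩ := exists_inv_expTransform_le hw h0 (by norm_num : (0 : ℝ) < 1 / 32)
  -- The factor `1/4` makes `G' = -f` contribute exactly `1/(4 P²)` to `h'`, so `4 t h'` cancels `t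
  -- h²`. Using `1 + t` in place of `t` avoids the singularity at `0`.
  set f : ℝ → ℝ := fun t => 1 / (4 * ((1 + t) ^ ((d : ℝ) / 2) * m t)) with hf_def
  have hfc : ∀ t, 0 ≤ t → ContinuousAt f t := fun t ht => by
    have h1 : (1 + t) ^ ((d : ℝ) / 2) ≠ 0 := (Real.rpow_pos_of_pos (by linarith) _).ne'
    refine continuousAt_const.div (continuousAt_const.mul (ContinuousAt.mul
      (ContinuousAt.rpow_const (by fun_prop) (Or.inl (by linarith))) hmc.continuousAt)) ?_
    exact mul_ne_zero four_ne_zero (mul_ne_zero h1 (hm t).ne')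
  have hf0 : ∀ t, 0 ≤ t → 0 ≤ f t := fun t ht => by
    have := hm t
    positivity
  have hfm : Measurable f := by
    have := hmc.measurable
    fun_prop
  have hfi : IntegrableOn f (Ioi 0) := by
    rw [← Ioc_union_Ioi_eq_Ioi (zero_le_one' ℝ)]
    refine IntegrableOn.union ?_ ?_
    · exact (ContinuousOn.integrableOn_Icc fun t ht => (hfc t ht.1).continuousWithinAt).mono_set
        Ioc_subset_Icc_self
    · refine hB.mono' hfm.aestronglyMeasurable
        ((ae_restrict_mem measurableSet_Ioi).mono fun t ht => ?_)
      have ht : (1 : ℝ) < t := ht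
      have h1 := hm t
      rw [Real.norm_of_nonneg (hf0 t (by linarith))]
      refine one_div_le_one_div_of_le (by positivity) ?_
      have h2 : t ^ ((d : ℝ) / 2) ≤ (1 + t) ^ ((d : ℝ) / 2) := by
        gcongr
        linarith
      have h3 := mul_le_mul_of_nonneg_right h2 h1.le
      have h4 : 0 < t ^ ((d : ℝ) / 2) * m t := by positivity
      linarith
  -- The tail integral is written as total minus initial part, ready for the fundamental theorem of
  -- calculus. The added `1` gives `G ≥ 1`, hence `P ≥ m` and `1/P ≤ 1/m`.
  set G : ℝ → ℝ := fun t => 1 + (∫ s in Ioi 0, f s) - ∫ s in (0 : ℝ)..t, f s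
  have hG1 : ∀ t, 0 ≤ t → 1 ≤ G t := fun t ht => by
    have : ∫ s in (0 : ℝ)..t, f s ≤ ∫ s in Ioi 0, f s := by
      rw [intervalIntegral.integral_of_le ht]
      exact setIntegral_mono_set hfi ((ae_restrict_mem measurableSet_Ioi).mono fun s hs =>
        hf0 s (le_of_lt hs)) Ioc_subset_Ioi_self.eventuallyLE
    simp only [G]
    linarith
  have hGd : ∀ t, 0 ≤ t → HasDerivAt G (-f t) t := fun t ht => by
    refine (intervalIntegral.integral_hasDerivAt_right ?_
      hfm.stronglyMeasurable.stronglyMeasurableAtFilter (hfc t ht)).const_sub _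
    rw [intervalIntegrable_iff_integrableOn_Ioc_of_le ht]
    exact hfi.mono_set Ioc_subset_Ioi_self
  set P : ℝ → ℝ := fun t => (1 + t) ^ ((d : ℝ) / 2) * G t * m t with hP_def
  set P' : ℝ → ℝ := fun t => d / 2 * P t / (1 + t) - 1 / 4 - P t * r t / 2 with hP'_def
  have hPm : ∀ t, 0 ≤ t → m t ≤ P t := fun t ht => by
    have h1 : 1 ≤ (1 + t) ^ ((d : ℝ) / 2) := Real.one_le_rpow (by linarith) (by positivity)
    have := hG1 t ht
    exact le_mul_of_one_le_left (hm t).le (by nlinarith)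
  have hP0 : ∀ t, 0 ≤ t → 0 < P t := fun t ht => (hm t).trans_le (hPm t ht)
  have hPd : ∀ t, 0 ≤ t → HasDerivAt P (P' t) t := fun t ht => by
    have h1 : 0 < 1 + t := by linarith
    have h2 := ((hasDerivAt_id t).const_add 1).rpow_const (p := (d : ℝ) / 2) (Or.inl h1.ne')
    refine ((h2.mul (hGd t ht)).mul (hmd t)).congr_deriv ?_
    simp only [hP'_def, hP_def, hf_def, id, Pi.mul_apply]
    rw [Real.rpow_sub_one h1.ne']
    have := Real.rpow_pos_of_pos h1 ((d : ℝ) / 2)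
    have := hm t
    field_simp
    ring
  have hPc : ContinuousOn P (Ici 0) := fun t ht => (hPd t ht).continuousAt.continuousWithinAt
  have hP'c : ContinuousOn P' (Ici 0) :=
    (((continuousOn_const.mul hPc).div (by fun_prop)
      fun t ht => by have : (0 : ℝ) ≤ t := ht; linarith).sub continuousOn_const).sub
      ((hPc.mul hrc.continuousOn).div_const 2)
  have hPinv : ∀ t, 0 ≤ t → (P t)⁻¹ ≤ C * Real.exp (t / 32) := fun t ht => by
    refine (inv_anti₀ (hm t) (hPm t ht)).trans ((hCle t ht).trans_eq ?_)
    ring_nf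
  have hd1 : (1 : ℝ) ≤ d := by exact_mod_cast hd
  refine ⟨fun t => (P t)⁻¹, hPc.inv₀ fun t ht => (hP0 t ht).ne', ?_⟩
  refine risk_lt_of_radial (r := r) (h := fun t => (P t)⁻¹) (h' := fun t => -P' t / P t ^ 2)
    (C := (d + 1) * C + C ^ 2) hrc.continuousOn (fun t _ => hr0 t) (fun t _ => hr1 t)
    (fun t ht => (hPd t ht).inv (hP0 t ht).ne')
    (hP'c.neg.div (hPc.pow 2) fun t ht => (pow_pos (hP0 t ht) 2).ne') (fun t ht => ?_)
    (fun t ht => ?_) (fun t ht => ?_)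
  · have hexp : Real.exp (t / 32) ≤ Real.exp (t / 16) := Real.exp_le_exp.2 (by linarith)
    have := hP0 t ht
    rw [abs_of_pos (by positivity)]
    refine (hPinv t ht).trans ?_
    have h1 : C ≤ (d + 1) * C + C ^ 2 := by nlinarith
    gcongr
  · have hP := hP0 t ht
    have hexp : Real.exp (t / 32) ≤ Real.exp (t / 16) := Real.exp_le_exp.2 (by linarith)
    have hexp2 : Real.exp (t / 32) ^ 2 = Real.exp (t / 16) := by
      rw [← Real.exp_nat_mul]
      congr 1
      push_cast
      ring
    have hi := hPinv t ht
    have hi0 : 0 < (P t)⁻¹ := by positivity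
    have hsq : (P t)⁻¹ ^ 2 ≤ C ^ 2 * Real.exp (t / 16) := by
      rw [← hexp2, ← mul_pow]
      exact pow_le_pow_left₀ hi0.le hi 2
    have hq : (P t)⁻¹ ≤ C * Real.exp (t / 16) :=
      hi.trans (mul_le_mul_of_nonneg_left hexp hC.le)
    have e : -P' t / P t ^ 2 =
        (P t)⁻¹ ^ 2 / 4 + (P t)⁻¹ * (r t / 2) - (P t)⁻¹ * (d / 2 * (1 + t)⁻¹) := by
      simp only [hP'_def]
      have : 0 < 1 + t := by linarith
      field_simp
      ring
    have hi1 : (1 + t)⁻¹ ≤ 1 := inv_le_one_of_one_le₀ (by linarith)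
    have hi2 : 0 ≤ (1 + t)⁻¹ := by positivity
    have a1 : (P t)⁻¹ * (r t / 2) ≤ (P t)⁻¹ * 1 :=
      mul_le_mul_of_nonneg_left (by linarith [hr1 t]) hi0.le
    have a2 : 0 ≤ (P t)⁻¹ * (r t / 2) := mul_nonneg hi0.le (by linarith [hr0 t])
    have a3 : (P t)⁻¹ * (d / 2 * (1 + t)⁻¹) ≤ (P t)⁻¹ * d :=
      mul_le_mul_of_nonneg_left (by nlinarith) hi0.le
    have a4 : 0 ≤ (P t)⁻¹ * (d / 2 * (1 + t)⁻¹) := by positivity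
    have a5 : (P t)⁻¹ * d ≤ C * Real.exp (t / 16) * d :=
      mul_le_mul_of_nonneg_right hq (by positivity)
    have a6 : 0 ≤ C ^ 2 * Real.exp (t / 16) := by positivity
    rw [e, abs_le]
    constructor <;> nlinarith
  · have hP := hP0 t ht
    have h1 : 0 < 1 + t := by linarith
    -- What survives is `(2d/P)(1 - t/(1+t))`, strictly positive also at `t = 0`.
    have e : 2 * (d * (P t)⁻¹ + 2 * t * (-P' t / P t ^ 2)) -
        (t * (P t)⁻¹ ^ 2 + 2 * t * (P t)⁻¹ * r t) = 2 * d / (P t * (1 + t)) := by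
      simp only [hP'_def]
      field_simp
      ring
    have : 0 < 2 * d / (P t * (1 + t)) := by positivity
    linarith

end ScaleMixture

theorem mainTheorem3 (d : ℕ) (a b c : ℝ) (had : a < (d : ℝ) / 2 - 1) (hb : -1 < b)
    (h : 0 < a ∨ (a = 0 ∧ 1 < c)) :
    -- the marginal density and the generalized Bayes estimator are well defined
    (∀ x : EuclideanSpace ℝ (Fin d),
      Integrable (fun θ => ScaleMixture.gaussDensity (x - θ))
          (ScaleMixture.mixPrior d (ScaleMixture.mixMeasure a b c)) ∧
        Integrable (fun θ => ScaleMixture.gaussDensity (x - θ) • θ)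
          (ScaleMixture.mixPrior d (ScaleMixture.mixMeasure a b c)) ∧
        0 < ScaleMixture.marginal
          (ScaleMixture.mixPrior d (ScaleMixture.mixMeasure a b c)) x) ∧
    -- the generalized Bayes estimator is inadmissible
    ScaleMixture.IsInadmissible
      (ScaleMixture.genBayes (ScaleMixture.mixPrior d (ScaleMixture.mixMeasure a b c))) ∧
    -- the marginal density is a function `m` of `‖x‖²`, and Brown's integral converges
    (∃ m : ℝ → ℝ,
      (∀ x : EuclideanSpace ℝ (Fin d),
        ScaleMixture.marginal (ScaleMixture.mixPrior d (ScaleMixture.mixMeasure a b c)) x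
          = m (‖x‖ ^ 2)) ∧
        IntegrableOn (fun t : ℝ => 1 / (t ^ ((d : ℝ) / 2) * m t)) (Ioi 1)) ∧
    IntegrableOn (fun g : ℝ => 1 / (g * ScaleMixture.mixDensity a b c g)) (Ioi 1) := by
  have hd : 0 < d := by
    -- For `d = 0` the bound on `a` would read `a < -1`, against `a ≥ 0`.
    rcases Nat.eq_zero_or_pos d with rfl | hd
    · rcases h with h | ⟨h, -⟩ <;> norm_num at had <;> linarith
    · exact hd
  have had' : a - (d : ℝ) / 2 < -1 := by linarith
  have hw : IntegrableOn (ScaleMixture.mixDensity (a - (d : ℝ) / 2) b c) (Ioi 0) :=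
    ScaleMixture.integrableOn_mixDensity_Ioi_zero had' hb
  have hpos : ∀ g : ℝ, 0 < g → 0 < ScaleMixture.mixDensity (a - (d : ℝ) / 2) b c g :=
    fun g hg => ScaleMixture.mixDensity_pos _ b c hg
  have hB := ScaleMixture.integrableOn_inv_expTransform (Nat.cast_nonneg d) had' hb h
  refine ⟨fun x => ⟨ScaleMixture.integrable_gaussDensity_mixPrior hw x,
    ScaleMixture.integrable_gaussDensity_smul_mixPrior hw x, ?_⟩, ?_,
    ⟨_, ScaleMixture.marginal_mixPrior hw, hB⟩, ScaleMixture.integrableOn_inv_mul_mixDensity h⟩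
  · rw [ScaleMixture.marginal_mixPrior hw]
    exact ScaleMixture.expTransform_pos hw hpos _
  · obtain ⟨k, hk, hlt⟩ := ScaleMixture.exists_dominating_radial hd hw hpos hB
    have hcm := ScaleMixture.continuous_expTransform hw
    have hcm1 := ScaleMixture.continuous_expTransform (ScaleMixture.integrableOn_div_one_add hw)
    have hck := ScaleMixture.continuous_comp_sq_norm (d := d) hk
    rw [funext (ScaleMixture.genBayes_mixPrior hw)]
    -- The improvement is strict at every `θ`, so `0` is an arbitrary witness.
    refine ⟨_, ?_, fun θ => (hlt θ).le, 0, hlt 0⟩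
    exact Continuous.measurable (((continuous_const.sub ((hcm1.comp (continuous_norm.pow 2)).div
      (hcm.comp (continuous_norm.pow 2)) fun x =>
        (ScaleMixture.expTransform_pos hw hpos _).ne')).smul continuous_id).sub
      (hck.smul continuous_id))
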